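/- Let $A=(a_{ij})_{i,j\in\mathcal I}$ be a generalized Cartan matrix with $\mathcal I$ finite, let $(\mathfrak h,\Pi=\{\alpha_i\}_{i\in\mathcal I},\Pi^\vee=\{\alpha_i^\vee\}_{i\in\mathcal I})$ be a realisation of $A$ over $\mathbb C$, and let $\mathfrak g=\mathfrak g(A)$ be the corresponding Kac–Moody algebra, i.e. the quotient of the Lie algebra $\bar{\mathfrak g}(A)$ generated by $e_i,f_i$ $(i\in\mathcal I)$ and $\mathfrak h$ modulo the Chevalley and Serre relations by the largest ideal of $\bar{\mathfrak g}(A)$ intersecting $\mathfrak h$ trivially. For a $\mathfrak g$-module $M$ and $\mu\in\mathfrak h^*$ let $M_\mu=\{v\in M : hv=\mu(h)v\ \ \forall h\in\mathfrak h\}$ and $\operatorname{wt}M=\{\mu\in\mathfrak h^* : M_\mu\ne 0\}$. For $x=\sum_{i\in\mathcal I}c_i\alpha_i$ $(c_i\in\mathbb C)$ let $\operatorname{supp}(x)=\{i\in\mathcal I : c_i\neq 0\}$. Let $\lambda\in\mathfrak h^*$ and let $M(\lambda)$ be the Verma module over $\mathfrak g$ with highest weight $\lambda$. Proposition 2.7.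 Among the proper submodules $K$ of $M(\lambda)$ with the property that for every $\mu\in\operatorname{wt}K$ the Dynkin subdiagram on $\operatorname{supp}(\lambda-\mu)$ has at least one edge, there is a largest one; denote it by $N(\lambda)$. Let $0\to N_V\to M(\lambda)\to V\to 0$ be an exact sequence of $\mathfrak g$-modules. Then $$\operatorname{wt}V=\operatorname{wt}M(\lambda)\quad\text{if and only if}\quad N_V\subseteq N(\lambda).$$ -/

import Mathlib

noncomputable section

namespace KacMoody

open Module

/-- A generalized Cartan matrix. -/
structure IsGCM {ι : Type*} (A : Matrix ι ι ℤ) : Prop where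
  diag : ∀ i, A i i = 2
  nonpos : ∀ i j, i ≠ j → A i j ≤ 0
  zero_symm : ∀ i j, A i j = 0 → A j i = 0

/-- A realisation `(𝔥, Π, Π^∨)` over `ℂ` of the matrix `A`: linearly independent simple roots
`α_i ∈ 𝔥^*` and simple coroots `α_i^∨ ∈ 𝔥` with `⟨α_j, α_i^∨⟩ = A i j` and
`dim 𝔥 = 2 |ι| - rank A`. -/
structure Realization {ι : Type*} [Fintype ι] (A : Matrix ι ι ℤ)
    (𝔥 : Type*) [AddCommGroup 𝔥] [Module ℂ 𝔥] where
  root : ι → Dual ℂ 𝔥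
  coroot : ι → 𝔥
  linearIndependent_root : LinearIndependent ℂ root
  linearIndependent_coroot : LinearIndependent ℂ coroot
  root_coroot : ∀ i j, root j (coroot i) = (A i j : ℂ)
  finiteDimensional : FiniteDimensional ℂ 𝔥
  finrank_add_rank : finrank ℂ 𝔥 + (A.map (Int.cast : ℤ → ℂ)).rank = 2 * Fintype.card ι

/-- The generators `e_i`, `f_i` (`i ∈ ι`) and `h ∈ 𝔥`. -/
inductive Gen (ι 𝔥 : Type*)
  | e : ι → Gen ι 𝔥
  | f : ι → Gen ι 𝔥
  | h : 𝔥 → Gen ι 𝔥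

section Construction

attribute [local instance 100] LieRing.ofAssociativeRing

variable {ι : Type*} [Fintype ι] [DecidableEq ι] {A : Matrix ι ι ℤ}
  {𝔥 : Type*} [AddCommGroup 𝔥] [Module ℂ 𝔥]

/-- The free Lie algebra on the generators. -/
abbrev FreeLie (ι 𝔥 : Type*) := FreeLieAlgebra ℂ (Gen ι 𝔥)

abbrev freeE (ι 𝔥 : Type*) (i : ι) : FreeLie ι 𝔥 := FreeLieAlgebra.of ℂ (Gen.e i)
abbrev freeF (ι 𝔥 : Type*) (i : ι) : FreeLie ι 𝔥 := FreeLieAlgebra.of ℂ (Gen.f i)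
abbrev freeH (ι : Type*) {𝔥 : Type*} (x : 𝔥) : FreeLie ι 𝔥 := FreeLieAlgebra.of ℂ (Gen.h x)

/-- The defining relations of `ḡ(A)`, as elements of the free Lie algebra to be killed:
linearity of `𝔥`, the Chevalley relations and the Serre relations. -/
inductive Rel (R : Realization A 𝔥) : FreeLie ι 𝔥 → Prop
  | add (x y : 𝔥) : Rel R (freeH ι (x + y) - (freeH ι x + freeH ι y))
  | smul (c : ℂ) (x : 𝔥) : Rel R (freeH ι (c • x) - c • freeH ι x)
  | hh (x y : 𝔥) : Rel R ⁅freeH ι x, freeH ι y⁆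
  | he (x : 𝔥) (i : ι) : Rel R (⁅freeH ι x, freeE ι 𝔥 i⁆ - R.root i x • freeE ι 𝔥 i)
  | hf (x : 𝔥) (i : ι) : Rel R (⁅freeH ι x, freeF ι 𝔥 i⁆ + R.root i x • freeF ι 𝔥 i)
  | ef_same (i : ι) : Rel R (⁅freeE ι 𝔥 i, freeF ι 𝔥 i⁆ - freeH ι (R.coroot i))
  | ef_ne (i j : ι) (hij : i ≠ j) : Rel R ⁅freeE ι 𝔥 i, freeF ι 𝔥 j⁆
  | serre_e (i j : ι) (hij : i ≠ j) :
      Rel R (((LieAlgebra.ad ℂ (FreeLie ι 𝔥) (freeE ι 𝔥 i)) ^ (1 - A i j).toNat) (freeE ι 𝔥 j))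
  | serre_f (i j : ι) (hij : i ≠ j) :
      Rel R (((LieAlgebra.ad ℂ (FreeLie ι 𝔥) (freeF ι 𝔥 i)) ^ (1 - A i j).toNat) (freeF ι 𝔥 j))

/-- The ideal generated by the defining relations. -/
def relIdeal (R : Realization A 𝔥) : LieIdeal ℂ (FreeLie ι 𝔥) :=
  LieSubmodule.lieSpan ℂ (FreeLie ι 𝔥) {x | Rel R x}

/-- The Lie algebra `ḡ(A)` generated by `e_i`, `f_i`, `𝔥` modulo the defining relations. -/
abbrev gBar (R : Realization A 𝔥) := FreeLie ι 𝔥 ⧸ relIdeal R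

/-- The sum of all ideals of `ḡ(A)` which intersect (the image of) `𝔥` trivially. -/
def radIdeal (R : Realization A 𝔥) : LieIdeal ℂ (gBar R) :=
  sSup {I : LieIdeal ℂ (gBar R) |
    ∀ x : 𝔥, LieSubmodule.Quotient.mk' (relIdeal R) (freeH ι x) ∈ I →
      LieSubmodule.Quotient.mk' (relIdeal R) (freeH ι x) = 0}

/-- The Kac--Moody algebra `𝔤(A)`: the quotient of `ḡ(A)` by its largest ideal intersecting `𝔥`
trivially. -/
def KM (R : Realization A 𝔥) := gBar R ⧸ radIdeal R

instance (R : Realization A 𝔥) : LieRing (KM R) :=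
  inferInstanceAs (LieRing (gBar R ⧸ radIdeal R))
instance (R : Realization A 𝔥) : LieAlgebra ℂ (KM R) :=
  inferInstanceAs (LieAlgebra ℂ (gBar R ⧸ radIdeal R))

/-- The class in `𝔤(A)` of an element of the free Lie algebra. -/
def KM.mk (R : Realization A 𝔥) (x : FreeLie ι 𝔥) : KM R :=
  LieSubmodule.Quotient.mk' (radIdeal R) (LieSubmodule.Quotient.mk' (relIdeal R) x)

def KM.e (R : Realization A 𝔥) (i : ι) : KM R := KM.mk R (freeE ι 𝔥 i)
def KM.f (R : Realization A 𝔥) (i : ι) : KM R := KM.mk R (freeF ι 𝔥 i)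
/-- The map `𝔥 → 𝔤(A)`. -/
def KM.h (R : Realization A 𝔥) (x : 𝔥) : KM R := KM.mk R (freeH ι x)

/-- The subalgebra `𝔫⁺` generated by the `e_i`. -/
def nPlus (R : Realization A 𝔥) : LieSubalgebra ℂ (KM R) :=
  LieSubalgebra.lieSpan ℂ (KM R) (Set.range (KM.e R))

/-- The universal enveloping algebra `U(𝔤)`. -/
abbrev U (R : Realization A 𝔥) := UniversalEnvelopingAlgebra ℂ (KM R)

/-- The left ideal of `U(𝔤)` generated by `𝔫⁺` and the elements `h - λ(h)`, `h ∈ 𝔥`. -/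
def vermaIdeal (R : Realization A 𝔥) (lam : Dual ℂ 𝔥) : Submodule (U R) (U R) :=
  Submodule.span (U R)
    ((UniversalEnvelopingAlgebra.ι ℂ) '' (nPlus R : Set (KM R)) ∪
      Set.range fun x : 𝔥 => UniversalEnvelopingAlgebra.ι ℂ (KM.h R x) -
        algebraMap ℂ (U R) (lam x))

/-- The Verma module `M(λ)`. -/
def Verma (R : Realization A 𝔥) (lam : Dual ℂ 𝔥) := U R ⧸ vermaIdeal R lam

instance (R : Realization A 𝔥) (lam : Dual ℂ 𝔥) : AddCommGroup (Verma R lam) :=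
  inferInstanceAs (AddCommGroup (U R ⧸ vermaIdeal R lam))
instance (R : Realization A 𝔥) (lam : Dual ℂ 𝔥) : Module (U R) (Verma R lam) :=
  inferInstanceAs (Module (U R) (U R ⧸ vermaIdeal R lam))
instance (R : Realization A 𝔥) (lam : Dual ℂ 𝔥) : Module ℂ (Verma R lam) :=
  inferInstanceAs (Module ℂ (U R ⧸ vermaIdeal R lam))
instance (R : Realization A 𝔥) (lam : Dual ℂ 𝔥) : IsScalarTower ℂ (U R) (Verma R lam) :=
  inferInstanceAs (IsScalarTower ℂ (U R) (U R ⧸ vermaIdeal R lam))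

/-- `𝔤` acts on `M(λ)` through `𝔤 → U(𝔤)`. -/
instance (R : Realization A 𝔥) (lam : Dual ℂ 𝔥) : LieRingModule (KM R) (Verma R lam) where
  bracket x m := UniversalEnvelopingAlgebra.ι ℂ x • m
  add_lie x y m := by
    change UniversalEnvelopingAlgebra.ι ℂ (x + y) • m = _
    rw [map_add, add_smul]
  lie_add x m n := smul_add _ m n
  leibniz_lie x y m := by
    change UniversalEnvelopingAlgebra.ι ℂ x • UniversalEnvelopingAlgebra.ι ℂ y • m =
      UniversalEnvelopingAlgebra.ι ℂ ⁅x, y⁆ • m +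
        UniversalEnvelopingAlgebra.ι ℂ y • UniversalEnvelopingAlgebra.ι ℂ x • m
    rw [LieHom.map_lie, LieRing.of_associative_ring_bracket, sub_smul, mul_smul, mul_smul,
      sub_add_cancel]

instance (R : Realization A 𝔥) (lam : Dual ℂ 𝔥) : LieModule ℂ (KM R) (Verma R lam) where
  smul_lie c x m := by
    change UniversalEnvelopingAlgebra.ι ℂ (c • x) • m =
      c • (UniversalEnvelopingAlgebra.ι ℂ x • m)
    rw [map_smul, smul_assoc]
  lie_smul c x m := by
    change UniversalEnvelopingAlgebra.ι ℂ x • (c • m) =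
      c • (UniversalEnvelopingAlgebra.ι ℂ x • m)
    rw [← algebraMap_smul (U R) c m, ← algebraMap_smul (U R) c, smul_smul, smul_smul,
      Algebra.commutes]

/-- The weight space `M_μ = {v | h v = μ(h) v for all h ∈ 𝔥}`. -/
def weightSpace (R : Realization A 𝔥) (M : Type*) [AddCommGroup M] [Module ℂ M]
    [LieRingModule (KM R) M] [LieModule ℂ (KM R) M] (μ : Dual ℂ 𝔥) : Submodule ℂ M where
  carrier := {v | ∀ x : 𝔥, ⁅KM.h R x, v⁆ = μ x • v}
  add_mem' ha hb x := by rw [lie_add, ha x, hb x, smul_add]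
  zero_mem' x := by rw [lie_zero, smul_zero]
  smul_mem' c v hv x := by rw [lie_smul, hv x, smul_comm]

/-- The set of weights `wt M`. -/
def wt (R : Realization A 𝔥) (M : Type*) [AddCommGroup M] [Module ℂ M]
    [LieRingModule (KM R) M] [LieModule ℂ (KM R) M] : Set (Dual ℂ 𝔥) :=
  {μ | weightSpace R M μ ≠ ⊥}

/-- The support `{i | c_i ≠ 0}` of `x = ∑ c_i α_i ∈ ℂΠ` (the `c_i` are unique, the simple roots
being linearly independent). -/
def supp (R : Realization A 𝔥) (x : Dual ℂ 𝔥) : Set ι :=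
  {i | ∃ c : ι → ℂ, x = ∑ j, c j • R.root j ∧ c i ≠ 0}

/-- The graph underlying the Dynkin diagram: distinct nodes `i`, `j` are joined when
`A i j ≠ 0` or `A j i ≠ 0`. -/
def dynkinGraph (A : Matrix ι ι ℤ) : SimpleGraph ι :=
  SimpleGraph.fromRel fun i j => A i j ≠ 0

/-- The edge property of a submodule `K` of `M(λ)`: for every weight `μ` of `K`, the Dynkin subdiagram
on `supp (λ - μ)` has at least one edge. -/
def HasEdgeProperty (R : Realization A 𝔥) (lam : Dual ℂ 𝔥)
    (K : LieSubmodule ℂ (KM R) (Verma R lam)) : Prop :=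
  ∀ μ ∈ wt R K, ((dynkinGraph A).induce (supp R (lam - μ))).edgeSet.Nonempty

/-- The submodule `N(λ)`: the sum of all proper submodules of `M(λ)` with the edge property. -/
def N (R : Realization A 𝔥) (lam : Dual ℂ 𝔥) : LieSubmodule ℂ (KM R) (Verma R lam) :=
  sSup {K | K ≠ ⊤ ∧ HasEdgeProperty R lam K}

end Construction

end KacMoody

end

/-! The weights of `M(λ)` are all the `λ - ∑ n_i α_i` with `n_i ∈ ℕ`. Such a sum is encoded by a
word in the index set, determined up to permutation; `fWord w v` is the corresponding monomial in
the `f_i` applied to the highest weight vector `v`. A weight occurring in a sum of submodules occurs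
in one of the summands, so the edge property passes to `N(λ)`; it also excludes the weight `λ`, so
properness comes for free.

If the letters of `w` are pairwise non-adjacent, the `f_i` involved commute and the weight space of
`M(λ)` at `w` is a line. A kernel meeting that line contains it, and the quotient loses the weight.
Hence equality of weights forces the edge property (`hasEdgeProperty_ker_of_wt_eq`).

Conversely, let the kernel have the edge property, so that `fWord w v ≠ 0` in `V` for every
non-adjacent `w`. That every `λ - w` is then a weight of `V` is `exists_mem_weightSubspace`, by
induction on the length of `w`. If some letter `j` with `λ(α_j^∨) ∈ ℕ` has a neighbour in `w`
occurring at least as often, all copies of `j` are removed and restored by an `sl₂`-string argument.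
Otherwise the letters with `λ(α_i^∨) ∈ ℕ` are pairwise non-adjacent, and the others act injectively
on the simple quotient, so their monomial can be raised back to `v` without disturbing the rest.

The argument also needs `fWord w v ≠ 0` in `M(λ)` for all `w`. This is obtained without PBW, by
mapping `M(λ)` to `L(μ) ⊗ L(λ - μ)` with `μ(α_i^∨) = -1` for all `i`. The simple modules `L` are
built as quotients of a module with basis the words, and the radical ideal is shown to act on them
by zero. -/

noncomputable section

namespace KacMoody

open Module

attribute [local instance 100] LieRing.ofAssociativeRing

/-! ### Simultaneous eigenspaces, and the grading of stable subspaces. -/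

section Weights

variable {𝔥 : Type*} [AddCommGroup 𝔥] [Module ℂ 𝔥] {W : Type*} [AddCommGroup W] [Module ℂ W]

/-- The simultaneous eigenspace of a family of operators indexed by `𝔥`. -/
def weightSubspace (T : 𝔥 → Module.End ℂ W) (μ : Dual ℂ 𝔥) : Submodule ℂ W :=
  ⨅ x, (T x).eigenspace (μ x)

theorem mem_weightSubspace {T : 𝔥 → Module.End ℂ W} {μ : Dual ℂ 𝔥} {w : W} :
    w ∈ weightSubspace T μ ↔ ∀ x, T x w = μ x • w := by
  simp [weightSubspace, Submodule.mem_iInf]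

/-- The sum of the weight spaces of weight different from `μ`. -/
def otherWeights (T : 𝔥 → Module.End ℂ W) (μ : Dual ℂ 𝔥) : Submodule ℂ W :=
  ⨆ ν : {ν : Dual ℂ 𝔥 // ν ≠ μ}, weightSubspace T ν

theorem weightSubspace_le_otherWeights {T : 𝔥 → Module.End ℂ W} {μ ν : Dual ℂ 𝔥} (h : ν ≠ μ) :
    weightSubspace T ν ≤ otherWeights T μ :=
  le_iSup (fun ν : {ν : Dual ℂ 𝔥 // ν ≠ μ} => weightSubspace T ν) ⟨ν, h⟩

/-- Applying `T x - μ x` removes the component of weight `μ` and rescales the others; with `x`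
separating `ν` from `μ`, the factor on the component at `ν` is invertible. -/
theorem mem_of_sum_mem {T : 𝔥 → Module.End ℂ W} {K : Submodule ℂ W}
    (hK : ∀ x, ∀ w ∈ K, T x w ∈ K) (s : Finset (Dual ℂ 𝔥)) :
    ∀ f : Dual ℂ 𝔥 → W, (∀ ν ∈ s, f ν ∈ weightSubspace T ν) → ∑ ν ∈ s, f ν ∈ K →
      ∀ ν ∈ s, f ν ∈ K := by
  classical
  induction s using Finset.induction_on with
  | empty => simp
  | insert μ s hμ ih =>
    intro f hf hs
    have key : ∀ ν ∈ s, f ν ∈ K := by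
      intro ν hν
      have hne : ν ≠ μ := fun h => hμ (h ▸ hν)
      obtain ⟨x, hx⟩ : ∃ x, ν x ≠ μ x := by
        by_contra! h
        exact hne (LinearMap.ext h)
      have h1 : ∑ τ ∈ s, (τ x - μ x) • f τ ∈ K := by
        have h2 := K.sub_mem (hK x _ hs) (K.smul_mem (μ x) hs)
        rw [map_sum, Finset.smul_sum, ← Finset.sum_sub_distrib, Finset.sum_insert hμ,
          mem_weightSubspace.1 (hf μ (Finset.mem_insert_self _ _)) x, sub_self, zero_add] at h2
        convert h2 using 1
        refine Finset.sum_congr rfl fun τ hτ => ?_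
        rw [mem_weightSubspace.1 (hf τ (Finset.mem_insert_of_mem hτ)) x, sub_smul]
      have h3 := ih (fun τ => (τ x - μ x) • f τ)
        (fun τ hτ => Submodule.smul_mem _ _ (hf τ (Finset.mem_insert_of_mem hτ))) h1 ν hν
      exact (Submodule.smul_mem_iff _ (sub_ne_zero.2 hx)).1 h3
    intro ν hν
    rcases Finset.mem_insert.1 hν with rfl | hν
    · rw [Finset.sum_insert hμ] at hs
      exact (Submodule.add_mem_iff_left _ (Submodule.sum_mem _ key)).1 hs
    · exact key ν hν

theorem mem_of_add_mem {T : 𝔥 → Module.End ℂ W} {K : Submodule ℂ W}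
    (hK : ∀ x, ∀ w ∈ K, T x w ∈ K) {μ : Dual ℂ 𝔥} {x y : W} (hx : x ∈ weightSubspace T μ)
    (hy : y ∈ otherWeights T μ) (hxy : x + y ∈ K) : x ∈ K := by
  classical
  -- The clause `ν = μ → f ν = 0` keeps the slot `μ` free, so that `x` can be inserted there.
  obtain ⟨f, hf, rfl⟩ : ∃ f : Dual ℂ 𝔥 →₀ W, (∀ ν, f ν ∈ weightSubspace T ν ∧ (ν = μ → f ν = 0)) ∧
      f.sum (fun _ w => w) = y := by
    refine Submodule.iSup_induction _ (motive := fun y => ∃ f : Dual ℂ 𝔥 →₀ W,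
      (∀ ν, f ν ∈ weightSubspace T ν ∧ (ν = μ → f ν = 0)) ∧ f.sum (fun _ w => w) = y) hy ?_ ?_ ?_
    · rintro ⟨τ, hτ⟩ w hw
      refine ⟨Finsupp.single τ w, fun ν => ?_, by simp⟩
      by_cases h : τ = ν
      · subst h
        simpa [hτ] using hw
      · simp [Finsupp.single_eq_of_ne' h]
    · exact ⟨0, by simp, by simp⟩
    · rintro _ _ ⟨f, hf, rfl⟩ ⟨g, hg, rfl⟩
      refine ⟨f + g, fun ν => ⟨Submodule.add_mem _ (hf ν).1 (hg ν).1, fun h => ?_⟩, ?_⟩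
      · simp [(hf ν).2 h, (hg ν).2 h]
      · exact Finsupp.sum_add_index' (fun _ => rfl) (fun _ _ _ => rfl)
  have hμ : μ ∉ f.support := by simp [(hf μ).2 rfl]
  have := mem_of_sum_mem hK (insert μ f.support) (fun ν => if ν = μ then x else f ν) ?_ ?_ μ
    (Finset.mem_insert_self _ _)
  · simpa using this
  · intro ν _
    by_cases h : ν = μ
    · subst h; simpa using hx
    · simpa [h] using (hf ν).1
  · rw [Finset.sum_insert hμ, if_pos rfl]
    convert hxy using 2
    refine Finset.sum_congr rfl fun ν hν => if_neg ?_
    rintro rfl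
    exact hμ hν

/-- The case `K = ⊥` of the grading: weight spaces are independent. -/
theorem eq_zero_of_mem_otherWeights {T : 𝔥 → Module.End ℂ W} {μ : Dual ℂ 𝔥} {x : W}
    (hx : x ∈ weightSubspace T μ) (hx' : x ∈ otherWeights T μ) : x = 0 := by
  have := mem_of_add_mem (K := (⊥ : Submodule ℂ W)) (T := T) (by simp) hx (neg_mem hx') (by simp)
  simpa using this

theorem exists_add_of_mem_span {T : 𝔥 → Module.End ℂ W} {β : Type*} {g : β → W}
    {φ : β → Dual ℂ 𝔥} (hg : ∀ b, g b ∈ weightSubspace T (φ b)) (μ : Dual ℂ 𝔥) {x : W}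
    (hx : x ∈ Submodule.span ℂ (Set.range g)) :
    ∃ a ∈ Submodule.span ℂ (g '' {b | φ b = μ}), ∃ y ∈ otherWeights T μ, x = a + y := by
  induction hx using Submodule.span_induction with
  | mem x hx =>
    obtain ⟨b, rfl⟩ := hx
    by_cases h : φ b = μ
    · exact ⟨g b, Submodule.subset_span ⟨b, h, rfl⟩, 0, zero_mem _, by simp⟩
    · exact ⟨0, zero_mem _, g b, weightSubspace_le_otherWeights h (hg b), by simp⟩
  | zero => exact ⟨0, zero_mem _, 0, zero_mem _, by simp⟩
  | add x y _ _ hx hy =>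
    obtain ⟨a, ha, b, hb, rfl⟩ := hx
    obtain ⟨c, hc, d, hd, rfl⟩ := hy
    exact ⟨a + c, add_mem ha hc, b + d, add_mem hb hd, by abel⟩
  | smul t x _ hx =>
    obtain ⟨a, ha, b, hb, rfl⟩ := hx
    exact ⟨t • a, Submodule.smul_mem _ _ ha, t • b, Submodule.smul_mem _ _ hb, smul_add _ _ _⟩

theorem span_image_le_weightSubspace {T : 𝔥 → Module.End ℂ W} {β : Type*} {g : β → W}
    {φ : β → Dual ℂ 𝔥} (hg : ∀ b, g b ∈ weightSubspace T (φ b)) (μ : Dual ℂ 𝔥) :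
    Submodule.span ℂ (g '' {b | φ b = μ}) ≤ weightSubspace T μ := by
  rw [Submodule.span_le]
  rintro _ ⟨b, rfl, rfl⟩
  exact hg b

theorem mem_span_image_of_mem_weightSubspace {T : 𝔥 → Module.End ℂ W} {β : Type*} {g : β → W}
    {φ : β → Dual ℂ 𝔥} (hg : ∀ b, g b ∈ weightSubspace T (φ b)) {μ : Dual ℂ 𝔥} {x : W}
    (hx : x ∈ Submodule.span ℂ (Set.range g)) (hμ : x ∈ weightSubspace T μ) :
    x ∈ Submodule.span ℂ (g '' {b | φ b = μ}) := by
  obtain ⟨a, ha, y, hy, rfl⟩ := exists_add_of_mem_span hg μ hx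
  have h := (Submodule.add_mem_iff_right _ (span_image_le_weightSubspace hg μ ha)).1 hμ
  rwa [eq_zero_of_mem_otherWeights h hy, add_zero]

/-- A weight occurring in a sum of submodules stable under the family occurs in one of them, if
weight vectors span. -/
theorem exists_inf_weightSubspace_ne_bot {T : 𝔥 → Module.End ℂ W} {β : Type*} {g : β → W}
    {φ : β → Dual ℂ 𝔥} (hg : ∀ b, g b ∈ weightSubspace T (φ b))
    (hspan : Submodule.span ℂ (Set.range g) = ⊤) {S : Set (Submodule ℂ W)}
    (hS : ∀ K ∈ S, ∀ x, ∀ w ∈ K, T x w ∈ K) {μ : Dual ℂ 𝔥} {x : W} (hx0 : x ≠ 0)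
    (hx : x ∈ sSup S) (hμ : x ∈ weightSubspace T μ) :
    ∃ K ∈ S, ∃ y ∈ K, y ∈ weightSubspace T μ ∧ y ≠ 0 := by
  by_contra! h
  refine hx0 (eq_zero_of_mem_otherWeights hμ ?_)
  have : sSup S ≤ otherWeights T μ := by
    refine sSup_le fun K hK k hk => ?_
    obtain ⟨a, ha, y, hy, rfl⟩ := exists_add_of_mem_span hg μ (hspan.ge (Submodule.mem_top (x := k)))
    have ha' := span_image_le_weightSubspace hg μ ha
    rwa [h K hK a (mem_of_add_mem (hS K hK) ha' hy hk) ha', zero_add]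
  exact this hx

end Weights

/-! ### Chevalley relations, and words as elements of the positive root cone. -/

/-- Elements of a Lie algebra satisfying the Chevalley relations. -/
structure ChevalleySystem {ι 𝔥 : Type*} [AddCommGroup 𝔥] [Module ℂ 𝔥] (G : Type*) [LieRing G]
    [LieAlgebra ℂ G] (r : ι → Dual ℂ 𝔥) (c : ι → 𝔥) where
  e : ι → G
  f : ι → G
  h : 𝔥 →ₗ[ℂ] G
  lie_h_h : ∀ x y, ⁅h x, h y⁆ = 0
  lie_h_e : ∀ x i, ⁅h x, e i⁆ = r i x • e i
  lie_h_f : ∀ x i, ⁅h x, f i⁆ = -(r i x • f i)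
  lie_e_f_same : ∀ i, ⁅e i, f i⁆ = h (c i)
  lie_e_f_ne : ∀ i j, i ≠ j → ⁅e i, f j⁆ = 0

/-- The weight `∑ r_i`, over the letters of a word. -/
def wordWeight {ι 𝔥 : Type*} [AddCommGroup 𝔥] [Module ℂ 𝔥] (r : ι → Dual ℂ 𝔥) (w : List ι) :
    Dual ℂ 𝔥 := (w.map r).sum

section WordWeight

variable {ι 𝔥 : Type*} [AddCommGroup 𝔥] [Module ℂ 𝔥] {r : ι → Dual ℂ 𝔥}

@[simp] theorem wordWeight_nil : wordWeight r [] = 0 := rfl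

@[simp] theorem wordWeight_cons (i : ι) (w : List ι) :
    wordWeight r (i :: w) = r i + wordWeight r w := by simp [wordWeight]

@[simp] theorem wordWeight_append (u w : List ι) :
    wordWeight r (u ++ w) = wordWeight r u + wordWeight r w := by simp [wordWeight]

theorem wordWeight_perm {u w : List ι} (h : u.Perm w) : wordWeight r u = wordWeight r w :=
  (h.map r).sum_eq

/-- The coefficients of `wordWeight r w` are the multiplicities of the letters, which linear
independence recovers in characteristic zero. -/
theorem perm_of_wordWeight_eq (hr : LinearIndependent ℂ r) {u w : List ι}
    (h : wordWeight r u = wordWeight r w) : u.Perm w := by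
  classical
  have h1 : ∀ w : List ι, wordWeight r w =
      Finsupp.linearCombination ℂ r (w.map fun i => (Finsupp.single i 1 : ι →₀ ℂ)).sum := by
    intro w
    induction w with
    | nil => simp [wordWeight]
    | cons i w ih => simp_all [wordWeight]
  have h2 : ∀ (w : List ι) (i : ι),
      (w.map fun i => (Finsupp.single i 1 : ι →₀ ℂ)).sum i = w.count i := by
    intro w i
    induction w with
    | nil => simp
    | cons j w ih => simp [ih, List.count_cons, Finsupp.single_apply, add_comm]
  rw [h1, h1] at h
  rw [List.perm_iff_count]
  intro i
  have h3 := DFunLike.congr_fun (hr h) i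
  simp only [h2] at h3
  exact_mod_cast h3

theorem wordWeight_eq_zero (hr : LinearIndependent ℂ r) {w : List ι}
    (h : wordWeight r w = 0) : w = [] := by
  have := perm_of_wordWeight_eq hr (u := w) (w := []) (by simpa using h)
  simpa using this

end WordWeight

namespace ChevalleySystem

section Lie

variable {ι 𝔥 : Type*} [AddCommGroup 𝔥] [Module ℂ 𝔥] {G : Type*} [LieRing G]
    [LieAlgebra ℂ G] {r : ι → Dual ℂ 𝔥} {c : ι → 𝔥}

/-- The Chevalley system with `e` and `f` exchanged. -/
def swap (D : ChevalleySystem G r c) : ChevalleySystem G (-r) (-c) where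
  e := D.f
  f := D.e
  h := D.h
  lie_h_h := D.lie_h_h
  lie_h_e x i := by simp [D.lie_h_f]
  lie_h_f x i := by simp [D.lie_h_e]
  lie_e_f_same i := by rw [← lie_skew, D.lie_e_f_same]; simp
  lie_e_f_ne i j h := by rw [← lie_skew, D.lie_e_f_ne _ _ h.symm]; simp

/-- The image of a Chevalley system under a homomorphism. -/
def map {G' : Type*} [LieRing G'] [LieAlgebra ℂ G'] (D : ChevalleySystem G r c)
    (φ : G →ₗ⁅ℂ⁆ G') : ChevalleySystem G' r c where
  e i := φ (D.e i)
  f i := φ (D.f i)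
  h := (φ : G →ₗ[ℂ] G') ∘ₗ D.h
  lie_h_h x y := by simp [← LieHom.map_lie, D.lie_h_h]
  lie_h_e x i := by simp [← LieHom.map_lie, D.lie_h_e]
  lie_h_f x i := by simp [← LieHom.map_lie, D.lie_h_f]
  lie_e_f_same i := by simp [← LieHom.map_lie, D.lie_e_f_same]
  lie_e_f_ne i j h := by simp [← LieHom.map_lie, D.lie_e_f_ne i j h]

end Lie

end ChevalleySystem

namespace ChevalleySystem

/-! ### Monomials in the operators, `sl₂`-strings, highest weight vectors and the radical. -/

section Operators

variable {ι 𝔥 : Type*} [AddCommGroup 𝔥] [Module ℂ 𝔥]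
  {W : Type*} [AddCommGroup W] [Module ℂ W] {r : ι → Dual ℂ 𝔥} {c : ι → 𝔥}
  (D : ChevalleySystem (Module.End ℂ W) r c)

theorem h_e_apply (x : 𝔥) (i : ι) (w : W) :
    D.h x (D.e i w) = D.e i (D.h x w) + r i x • D.e i w := by
  have := LinearMap.congr_fun (D.lie_h_e x i) w
  rw [LieRing.of_associative_ring_bracket] at this
  simp only [LinearMap.sub_apply, Module.End.mul_apply, LinearMap.smul_apply] at this
  rw [← this]; abel

theorem h_f_apply (x : 𝔥) (i : ι) (w : W) :
    D.h x (D.f i w) = D.f i (D.h x w) - r i x • D.f i w := by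
  have := LinearMap.congr_fun (D.lie_h_f x i) w
  rw [LieRing.of_associative_ring_bracket] at this
  simp only [LinearMap.sub_apply, Module.End.mul_apply, LinearMap.smul_apply,
    LinearMap.neg_apply] at this
  rw [sub_eq_add_neg, ← this]; abel

theorem e_f_apply_same (i : ι) (w : W) :
    D.e i (D.f i w) = D.f i (D.e i w) + D.h (c i) w := by
  have := LinearMap.congr_fun (D.lie_e_f_same i) w
  rw [LieRing.of_associative_ring_bracket] at this
  simp only [LinearMap.sub_apply, Module.End.mul_apply] at this
  rw [← this]; abel

theorem e_f_apply_ne {i j : ι} (h : i ≠ j) (w : W) :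
    D.e i (D.f j w) = D.f j (D.e i w) := by
  have := LinearMap.congr_fun (D.lie_e_f_ne i j h) w
  rw [LieRing.of_associative_ring_bracket] at this
  simpa only [LinearMap.sub_apply, Module.End.mul_apply, LinearMap.zero_apply, sub_eq_zero]
    using this

/-- The product of the operators `f i` over a word. -/
def fWord (w : List ι) : Module.End ℂ W := (w.map D.f).prod

/-- The product of the operators `e i` over a word. -/
def eWord (w : List ι) : Module.End ℂ W := (w.map D.e).prod

@[simp] theorem fWord_nil_apply (v : W) : D.fWord [] v = v := rfl
@[simp] theorem eWord_nil_apply (v : W) : D.eWord [] v = v := rfl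
@[simp] theorem fWord_cons_apply (i : ι) (w : List ι) (v : W) :
    D.fWord (i :: w) v = D.f i (D.fWord w v) := by simp [fWord]
@[simp] theorem eWord_cons_apply (i : ι) (w : List ι) (v : W) :
    D.eWord (i :: w) v = D.e i (D.eWord w v) := by simp [eWord]
theorem fWord_append_apply (u w : List ι) (v : W) :
    D.fWord (u ++ w) v = D.fWord u (D.fWord w v) := by simp [fWord]
theorem eWord_append_apply (u w : List ι) (v : W) :
    D.eWord (u ++ w) v = D.eWord u (D.eWord w v) := by simp [eWord]
theorem fWord_replicate_apply (n : ℕ) (i : ι) (v : W) :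
    D.fWord (List.replicate n i) v = (D.f i ^ n) v := by simp [fWord]

variable {D}

theorem e_mem_weightSubspace {μ : Dual ℂ 𝔥} {x : W} (i : ι) (hx : x ∈ weightSubspace D.h μ) :
    D.e i x ∈ weightSubspace D.h (μ + r i) := by
  rw [mem_weightSubspace] at hx ⊢
  intro y
  rw [h_e_apply, hx, map_smul, ← add_smul, LinearMap.add_apply]

theorem f_mem_weightSubspace {μ : Dual ℂ 𝔥} {x : W} (i : ι) (hx : x ∈ weightSubspace D.h μ) :
    D.f i x ∈ weightSubspace D.h (μ - r i) := by
  rw [mem_weightSubspace] at hx ⊢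
  intro y
  rw [h_f_apply, hx, map_smul, ← sub_smul, LinearMap.sub_apply]

theorem eWord_mem_weightSubspace {μ : Dual ℂ 𝔥} {x : W} (w : List ι)
    (hx : x ∈ weightSubspace D.h μ) :
    D.eWord w x ∈ weightSubspace D.h (μ + wordWeight r w) := by
  induction w with
  | nil => simpa using hx
  | cons i w ih =>
    have := e_mem_weightSubspace i ih
    rwa [eWord_cons_apply, wordWeight_cons, add_comm (r i), ← add_assoc]

theorem fWord_mem_weightSubspace {μ : Dual ℂ 𝔥} {x : W} (w : List ι)
    (hx : x ∈ weightSubspace D.h μ) :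
    D.fWord w x ∈ weightSubspace D.h (μ - wordWeight r w) := by
  induction w with
  | nil => simpa using hx
  | cons i w ih =>
    have := f_mem_weightSubspace i ih
    rwa [fWord_cons_apply, wordWeight_cons, add_comm (r i), ← sub_sub]

theorem e_f_pow_apply {i : ι} (hi : r i (c i) = 2) {x : W} {m : ℂ} (hx : D.h (c i) x = m • x)
    (he : D.e i x = 0) (n : ℕ) :
    D.e i ((D.f i ^ (n + 1)) x) = ((n + 1 : ℂ) * (m - n)) • (D.f i ^ n) x := by
  have hh : ∀ k : ℕ, D.h (c i) ((D.f i ^ k) x) = (m - 2 * k) • (D.f i ^ k) x := by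
    intro k
    induction k with
    | zero => simpa using hx
    | succ k ih =>
      rw [pow_succ', Module.End.mul_apply, h_f_apply, ih, map_smul, hi, ← sub_smul]
      congr 1
      push_cast
      ring
  induction n with
  | zero => simp [e_f_apply_same, he, hx]
  | succ n ih =>
    rw [pow_succ', Module.End.mul_apply, e_f_apply_same, ih, hh, map_smul, ← Module.End.mul_apply,
      ← pow_succ', ← add_smul]
    congr 1
    push_cast
    ring

/-- The scalar is the product of the `(k + 1)(m - k)` over `k < n`, which vanishes only if `m` is
one of `0, …, n - 1`. -/
theorem exists_e_pow_f_pow_apply {i : ι} (hi : r i (c i) = 2) {x : W} {m : ℂ}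
    (hx : D.h (c i) x = m • x) (he : D.e i x = 0) (n : ℕ) (hm : ∀ k : ℕ, k < n → m ≠ k) :
    ∃ a : ℂ, a ≠ 0 ∧ (D.e i ^ n) ((D.f i ^ n) x) = a • x := by
  induction n with
  | zero => exact ⟨1, one_ne_zero, by simp⟩
  | succ n ih =>
    obtain ⟨a, ha, h⟩ := ih fun k hk => hm k (by omega)
    refine ⟨((n + 1 : ℂ) * (m - n)) * a, ?_, ?_⟩
    · exact mul_ne_zero (mul_ne_zero (by exact_mod_cast n.succ_ne_zero)
        (sub_ne_zero.2 (hm n n.lt_succ_self))) ha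
    · rw [pow_succ (D.e i), Module.End.mul_apply, e_f_pow_apply hi hx he, map_smul, h, smul_smul]

theorem f_pow_ne_zero {i : ι} (hi : r i (c i) = 2) {x : W} (hx0 : x ≠ 0) {m : ℂ}
    (hx : D.h (c i) x = m • x) (he : D.e i x = 0) (n : ℕ) (hm : ∀ k : ℕ, k < n → m ≠ k) :
    (D.f i ^ n) x ≠ 0 := by
  obtain ⟨a, ha, h⟩ := exists_e_pow_f_pow_apply hi hx he n hm
  intro h0
  rw [h0, map_zero] at h
  exact smul_ne_zero ha hx0 h.symm

variable (D)

/-- `v` is a nonzero highest weight vector of weight `lam` which generates. -/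
structure IsHighestWeight (lam : Dual ℂ 𝔥) (v : W) : Prop where
  ne_zero : v ≠ 0
  e_apply : ∀ i, D.e i v = 0
  mem_weight : v ∈ weightSubspace D.h lam
  span_eq_top : Submodule.span ℂ (Set.range fun w => D.fWord w v) = ⊤

/-- A subspace stable under a Chevalley system of operators. -/
structure IsStable (K : Submodule ℂ W) : Prop where
  e_mem : ∀ i, ∀ x ∈ K, D.e i x ∈ K
  f_mem : ∀ i, ∀ x ∈ K, D.f i x ∈ K
  h_mem : ∀ y, ∀ x ∈ K, D.h y x ∈ K

/-- The span of the images of `v` under nonempty words in the `f i`. -/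
def lower (v : W) : Submodule ℂ W :=
  Submodule.span ℂ (Set.range fun w : {w : List ι // w ≠ []} => D.fWord w v)

/-- The vectors from which the `e i` do not reach outside `lower v`. -/
def rad (v : W) : Submodule ℂ W := ⨅ u : List ι, (D.lower v).comap (D.eWord u)

variable {D}

theorem mem_rad {v x : W} : x ∈ D.rad v ↔ ∀ u, D.eWord u x ∈ D.lower v := by
  simp [rad, Submodule.mem_iInf]

theorem e_mem_rad {i : ι} {x : W} (hx : x ∈ D.rad v) :
    D.e i x ∈ D.rad v := by
  rw [mem_rad] at hx ⊢
  intro u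
  simpa [eWord_append_apply] using hx (u ++ [i])

theorem rad_le_lower {v : W} : D.rad v ≤ D.lower v :=
  fun _ hx => mem_rad.1 hx []

theorem IsStable.eWord_mem {K : Submodule ℂ W}
    (hK : D.IsStable K) {x : W} (hx : x ∈ K) (u : List ι) : D.eWord u x ∈ K := by
  induction u with
  | nil => simpa using hx
  | cons i u ih => simpa using hK.e_mem i _ ih

namespace IsHighestWeight

variable {lam : Dual ℂ 𝔥} {v : W} (H : D.IsHighestWeight lam v)
include H

theorem h_apply (x : 𝔥) : D.h x v = lam x • v := mem_weightSubspace.1 H.mem_weight x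

theorem fWord_mem (w : List ι) : D.fWord w v ∈ weightSubspace D.h (lam - wordWeight r w) :=
  fWord_mem_weightSubspace w H.mem_weight

theorem lower_le_otherWeights (hr : LinearIndependent ℂ r) :
    D.lower v ≤ otherWeights D.h lam := by
  rw [lower, Submodule.span_le]
  rintro _ ⟨⟨w, hw⟩, rfl⟩
  refine weightSubspace_le_otherWeights (fun h => hw ?_) (H.fWord_mem w)
  exact wordWeight_eq_zero hr (by simpa using h)

theorem exists_add_lower (x : W) : ∃ a : ℂ, ∃ y ∈ D.lower v, x = a • v + y := by
  have hx : x ∈ Submodule.span ℂ (Set.range fun w => D.fWord w v) :=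
    H.span_eq_top.ge Submodule.mem_top
  induction hx using Submodule.span_induction with
  | mem x hx =>
    obtain ⟨w, rfl⟩ := hx
    by_cases hw : w = []
    · exact ⟨1, 0, zero_mem _, by simp [hw]⟩
    · exact ⟨0, _, Submodule.subset_span ⟨⟨w, hw⟩, rfl⟩, by simp⟩
  | zero => exact ⟨0, 0, zero_mem _, by simp⟩
  | add x y _ _ hx hy =>
    obtain ⟨a, b, hb, rfl⟩ := hx
    obtain ⟨a', d, hd, rfl⟩ := hy
    exact ⟨a + a', b + d, add_mem hb hd, by rw [add_smul]; abel⟩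
  | smul t x _ hx =>
    obtain ⟨a, b, hb, rfl⟩ := hx
    exact ⟨t * a, t • b, Submodule.smul_mem _ _ hb, by rw [smul_add, smul_smul]⟩

theorem f_mem_lower (i : ι) (x : W) : D.f i x ∈ D.lower v := by
  have hx : x ∈ Submodule.span ℂ (Set.range fun w => D.fWord w v) :=
    H.span_eq_top.ge Submodule.mem_top
  induction hx using Submodule.span_induction with
  | mem x hx =>
    obtain ⟨w, rfl⟩ := hx
    exact Submodule.subset_span ⟨⟨i :: w, by simp⟩, by simp⟩
  | zero => simp
  | add x y _ _ hx hy => simpa using add_mem hx hy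
  | smul t x _ hx => simpa using Submodule.smul_mem _ t hx

theorem h_mem_lower (y : 𝔥) {x : W} (hx : x ∈ D.lower v) : D.h y x ∈ D.lower v := by
  induction hx using Submodule.span_induction with
  | mem x hx =>
    obtain ⟨⟨w, hw⟩, rfl⟩ := hx
    dsimp only
    rw [mem_weightSubspace.1 (H.fWord_mem w) y]
    exact Submodule.smul_mem _ _ (Submodule.subset_span ⟨⟨w, hw⟩, rfl⟩)
  | zero => simp
  | add x y _ _ hx hy => simpa using add_mem hx hy
  | smul t x _ hx => simpa using Submodule.smul_mem _ t hx

theorem notMem_lower (hr : LinearIndependent ℂ r) : v ∉ D.lower v := fun h =>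
  H.ne_zero (eq_zero_of_mem_otherWeights H.mem_weight (H.lower_le_otherWeights hr h))

theorem h_mem_rad (y : 𝔥) {x : W} (hx : x ∈ D.rad v) : D.h y x ∈ D.rad v := by
  rw [mem_rad] at hx ⊢
  have key : ∀ u : List ι, D.eWord u (D.h y x) =
      D.h y (D.eWord u x) - wordWeight r u y • D.eWord u x := by
    intro u
    induction u with
    | nil => simp
    | cons i u ih =>
      simp only [eWord_cons_apply, ih, map_sub, map_smul, h_e_apply, wordWeight_cons,
        LinearMap.add_apply, add_smul]
      abel
  intro u
  rw [key]
  exact sub_mem (H.h_mem_lower y (hx u)) (Submodule.smul_mem _ _ (hx u))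

/-- Commuting the raising operators past `f i`, starting from the one that acts first (the last
letter of `u`), produces only terms with `e j x` and `h x`, again in the radical. -/
theorem f_mem_rad (i : ι) {x : W} (hx : x ∈ D.rad v) : D.f i x ∈ D.rad v := by
  rw [mem_rad]
  intro u
  induction u using List.reverseRecOn generalizing x with
  | nil => exact H.f_mem_lower i x
  | append_singleton u j ih =>
    rw [eWord_append_apply, eWord_cons_apply, eWord_nil_apply]
    by_cases h : j = i
    · subst h
      rw [e_f_apply_same, map_add]
      exact add_mem (ih (e_mem_rad hx)) (mem_rad.1 (H.h_mem_rad _ hx) u)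
    · rw [e_f_apply_ne _ h]
      exact ih (e_mem_rad hx)

theorem isStable_rad : D.IsStable (D.rad v) where
  e_mem _ _ hx := e_mem_rad hx
  f_mem i _ hx := H.f_mem_rad i hx
  h_mem y _ hx := H.h_mem_rad y hx

theorem notMem_rad (hr : LinearIndependent ℂ r) : v ∉ D.rad v := fun h =>
  H.notMem_lower hr (rad_le_lower h)

/-- Together with `isStable_rad` and `notMem_rad` this makes `rad v` the largest stable subspace
avoiding `v`. A component `a • v` with `a ≠ 0` reached by raising an element of `K` would lie in
`K`, since `K` is graded. -/
theorem le_rad_of_notMem (hr : LinearIndependent ℂ r) {K : Submodule ℂ W} (hK : D.IsStable K)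
    (hv : v ∉ K) : K ≤ D.rad v := by
  intro x hx
  rw [mem_rad]
  intro u
  obtain ⟨a, y, hy, h⟩ := H.exists_add_lower (D.eWord u x)
  have hu := hK.eWord_mem hx u
  rw [h] at hu ⊢
  have ha : a • v ∈ K := mem_of_add_mem hK.h_mem (Submodule.smul_mem _ a H.mem_weight)
    (H.lower_le_otherWeights hr hy) hu
  by_cases ha0 : a = 0
  · simpa [ha0] using hy
  · exact absurd ((Submodule.smul_mem_iff _ ha0).1 ha) hv

/-- A vector of weight `lam - wordWeight r w` outside the radical can be raised to `v` by a
rearrangement of `w`. -/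
theorem exists_eWord_eq (hr : LinearIndependent ℂ r) {w : List ι} {x : W}
    (hx : x ∈ weightSubspace D.h (lam - wordWeight r w)) (hxr : x ∉ D.rad v) :
    ∃ u : List ι, u.Perm w ∧ ∃ a : ℂ, a ≠ 0 ∧ D.eWord u x = a • v := by
  rw [mem_rad] at hxr
  push Not at hxr
  obtain ⟨u, hu⟩ := hxr
  have hw := eWord_mem_weightSubspace u hx
  obtain ⟨a, y, hy, h⟩ := H.exists_add_lower (D.eWord u x)
  -- The raised vector has a single weight; were it not `lam`, its component along `v` would vanish
  -- and it would lie in `lower v`.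
  have hlam : lam - wordWeight r w + wordWeight r u = lam := by
    by_contra hne
    refine hu ?_
    rw [h]
    have h1 : a • v = 0 := by
      refine eq_zero_of_mem_otherWeights (Submodule.smul_mem _ a H.mem_weight) ?_
      rw [← sub_eq_iff_eq_add.2 h]
      exact sub_mem (weightSubspace_le_otherWeights hne hw) (H.lower_le_otherWeights hr hy)
    rwa [h1, zero_add]
  have hy0 : y = 0 := by
    rw [hlam] at hw
    refine eq_zero_of_mem_otherWeights ?_ (H.lower_le_otherWeights hr hy)
    rw [h] at hw
    exact (Submodule.add_mem_iff_right _ (Submodule.smul_mem _ a H.mem_weight)).1 hw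
  refine ⟨u, perm_of_wordWeight_eq hr ?_, a, ?_, by rw [h, hy0, add_zero]⟩
  · rw [sub_add, sub_eq_self, sub_eq_zero] at hlam
    exact hlam.symm
  · rintro rfl
    exact hu (by rw [h, hy0]; simp)

/-- Weights of a highest weight space. -/
theorem exists_word_of_weightSubspace_ne_bot {μ : Dual ℂ 𝔥} {x : W} (hx0 : x ≠ 0)
    (hx : x ∈ weightSubspace D.h μ) : ∃ w : List ι, μ = lam - wordWeight r w := by
  have := mem_span_image_of_mem_weightSubspace H.fWord_mem
    (H.span_eq_top.ge (Submodule.mem_top (x := x))) hx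
  by_contra! h
  rw [show {b : List ι | lam - wordWeight r b = μ} = ∅ from
    Set.eq_empty_iff_forall_notMem.2 fun w hw => h w hw.symm] at this
  simp at this
  exact hx0 this

/-- `lam + r i` minus a word without `i` is not a weight. -/
theorem e_apply_eq_zero (hr : LinearIndependent ℂ r) {w : List ι} {i : ι} (hi : i ∉ w) {x : W}
    (hx : x ∈ weightSubspace D.h (lam - wordWeight r w)) : D.e i x = 0 := by
  by_contra h
  obtain ⟨u, hu⟩ := H.exists_word_of_weightSubspace_ne_bot h (e_mem_weightSubspace i hx)
  have : (i :: u).Perm w := by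
    refine perm_of_wordWeight_eq hr ?_
    rw [wordWeight_cons]
    rw [← sub_eq_zero, ← sub_eq_zero.2 hu]
    abel
  exact hi (this.subset (by simp))

end IsHighestWeight

end Operators

end ChevalleySystem

/-! ### Vectors that are torsion for one operator modulo a subspace. -/

section Torsion

variable {W : Type*} [AddCommGroup W] [Module ℂ W]

/-- The vectors mapped into `K` by some power of `a`. -/
def torsionMod (a : Module.End ℂ W) (K : Submodule ℂ W) (hK : ∀ x ∈ K, a x ∈ K) :
    Submodule ℂ W where
  carrier := {x | ∃ n : ℕ, (a ^ n) x ∈ K}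
  add_mem' := by
    have key : ∀ (x : W) (n m : ℕ), (a ^ n) x ∈ K → (a ^ (m + n)) x ∈ K := by
      intro x n m h
      induction m with
      | zero => simpa using h
      | succ m ih =>
        rw [add_right_comm, pow_succ', Module.End.mul_apply]
        exact hK _ ih
    rintro x y ⟨n, hn⟩ ⟨m, hm⟩
    refine ⟨m + n, ?_⟩
    rw [map_add]
    refine add_mem (key x n m hn) ?_
    rw [add_comm]
    exact key y m n hm
  zero_mem' := ⟨0, by simp⟩
  smul_mem' t x := by
    rintro ⟨n, hn⟩
    exact ⟨n, by rw [map_smul]; exact K.smul_mem t hn⟩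

variable {a : Module.End ℂ W} {K : Submodule ℂ W} (hK : ∀ x ∈ K, a x ∈ K)

theorem torsionMod_of_apply {x : W} (h : a x ∈ torsionMod a K hK) : x ∈ torsionMod a K hK := by
  obtain ⟨n, hn⟩ := h
  exact ⟨n + 1, by rwa [pow_succ, Module.End.mul_apply]⟩

/-- Since `a (b x) = b (a x) + ⁅a, b⁆ x`, induction on the order of torsion of `x` applies to `a x`,
and an element whose image under `a` is torsion is torsion. -/
theorem apply_mem_torsionMod {b : Module.End ℂ W} (hb : ∀ x ∈ K, b x ∈ K)
    (hab : ∀ x ∈ torsionMod a K hK, ⁅a, b⁆ x ∈ torsionMod a K hK) :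
    ∀ x ∈ torsionMod a K hK, b x ∈ torsionMod a K hK := by
  rintro x ⟨n, hn⟩
  induction n generalizing x with
  | zero => exact ⟨0, by simpa using hb x (by simpa using hn)⟩
  | succ n ih =>
    refine torsionMod_of_apply hK ?_
    have h1 : a (b x) = b (a x) + ⁅a, b⁆ x := by
      rw [LieRing.of_associative_ring_bracket]
      simp
    rw [h1]
    refine add_mem (ih (a x) ?_) (hab x ⟨n + 1, hn⟩)
    rwa [pow_succ, Module.End.mul_apply] at hn

theorem apply_mem_torsionMod_of_ad_pow (N : ℕ) {b : Module.End ℂ W} (hb : ∀ x ∈ K, b x ∈ K)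
    (hN : ((LieAlgebra.ad ℂ (Module.End ℂ W) a) ^ N) b = 0) :
    ∀ x ∈ torsionMod a K hK, b x ∈ torsionMod a K hK := by
  induction N generalizing b with
  | zero =>
    have : b = 0 := by simpa using hN
    simp [this]
  | succ N ih =>
    refine apply_mem_torsionMod hK hb (ih (b := ⁅a, b⁆) ?_ ?_)
    · intro x hx
      rw [LieRing.of_associative_ring_bracket]
      exact sub_mem (hK _ (hb _ hx)) (hb _ (hK _ hx))
    · rwa [pow_succ, Module.End.mul_apply, LieAlgebra.ad_apply] at hN

end Torsion

namespace ChevalleySystem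

/-! ### Which weights occur in a highest weight space. -/

section Operators

variable {ι 𝔥 : Type*} [AddCommGroup 𝔥] [Module ℂ 𝔥]
  {W : Type*} [AddCommGroup W] [Module ℂ W] {r : ι → Dual ℂ 𝔥} {c : ι → 𝔥}
  {D : ChevalleySystem (Module.End ℂ W) r c}

/-- The Serre relations give the `f j` by local nilpotency. Then `⁅f i, h⁆` is a multiple of `f i`,
which gives the `h`, and `⁅f i, e j⁆` is zero or in the image of `h`, which gives the `e j`. -/
theorem IsStable.torsionMod
    (hS : ∀ i j, ∃ N : ℕ, ((LieAlgebra.ad ℂ (Module.End ℂ W) (D.f i)) ^ N) (D.f j) = 0)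
    {K : Submodule ℂ W} (hK : D.IsStable K) (i : ι) :
    D.IsStable (torsionMod (D.f i) K (hK.f_mem i)) := by
  have hf : ∀ j, ∀ x ∈ KacMoody.torsionMod (D.f i) K (hK.f_mem i),
      D.f j x ∈ KacMoody.torsionMod (D.f i) K (hK.f_mem i) := fun j =>
    let ⟨N, hN⟩ := hS i j
    apply_mem_torsionMod_of_ad_pow _ N (hK.f_mem j) hN
  have hh : ∀ y, ∀ x ∈ KacMoody.torsionMod (D.f i) K (hK.f_mem i),
      D.h y x ∈ KacMoody.torsionMod (D.f i) K (hK.f_mem i) := fun y => by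
    refine apply_mem_torsionMod _ (hK.h_mem y) fun x hx => ?_
    rw [← lie_skew, D.lie_h_f, neg_neg]
    exact Submodule.smul_mem _ _ (hf i x hx)
  refine ⟨fun j => apply_mem_torsionMod _ (hK.e_mem j) fun x hx => ?_, hf, hh⟩
  rw [← lie_skew]
  by_cases h : j = i
  · subst h
    rw [D.lie_e_f_same]
    exact neg_mem (hh _ x hx)
  · rw [D.lie_e_f_ne _ _ h]
    simp

theorem eWord_fWord_comm {u a : List ι} (h : ∀ i ∈ u, ∀ j ∈ a, i ≠ j) (x : W) :
    D.eWord u (D.fWord a x) = D.fWord a (D.eWord u x) := by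
  have h1 : ∀ i ∈ u, ∀ y, D.e i (D.fWord a y) = D.fWord a (D.e i y) := by
    intro i hi y
    clear x
    induction a with
    | nil => simp
    | cons j a ih =>
      rw [fWord_cons_apply, fWord_cons_apply, e_f_apply_ne _ (h i hi j (by simp)),
        ih fun k hk l hl => h k hk l (by simp [hl])]
  clear h
  induction u with
  | nil => simp
  | cons i u ih =>
    rw [eWord_cons_apply, eWord_cons_apply, ih fun k hk => h1 k (by simp [hk]), h1 i (by simp)]

namespace IsHighestWeight

variable {lam : Dual ℂ 𝔥} {v : W} (H : D.IsHighestWeight lam v)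
include H

/-- For `lam (c i) ∉ ℕ`, `f i` is injective modulo the radical: its torsion is a stable subspace,
and it omits `v` because `e i ^ n` takes `f i ^ n v` to a nonzero multiple of `v`. By maximality the
torsion lies in the radical. -/
theorem fWord_notMem_rad (hr : LinearIndependent ℂ r) (hrc : ∀ i, r i (c i) = 2)
    (hS : ∀ i j, ∃ N : ℕ, ((LieAlgebra.ad ℂ (Module.End ℂ W) (D.f i)) ^ N) (D.f j) = 0)
    {w : List ι} (hw : ∀ i ∈ w, ∀ n : ℕ, lam (c i) ≠ n) : D.fWord w v ∉ D.rad v := by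
  induction w with
  | nil => simpa using H.notMem_rad hr
  | cons i w ih =>
    rw [fWord_cons_apply]
    intro h
    refine ih (fun j hj => hw j (by simp [hj])) ?_
    have hT := H.isStable_rad.torsionMod hS i
    refine H.le_rad_of_notMem hr hT ?_ ⟨1, by simpa using h⟩
    rintro ⟨n, hn⟩
    obtain ⟨a, ha, hav⟩ := exists_e_pow_f_pow_apply (hrc i) (H.h_apply (c i)) (H.e_apply i) n
      fun k _ => hw i (by simp) k
    have h1 := H.isStable_rad.eWord_mem hn (List.replicate n i)
    rw [eWord, List.map_replicate, List.prod_replicate, hav] at h1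
    exact H.notMem_rad hr ((Submodule.smul_mem_iff _ ha).1 h1)

/-- All of `lam - ℕ Π` occurs, provided it does for independent sets of simple roots. -/
theorem exists_mem_weightSubspace (hr : LinearIndependent ℂ r) {A : Matrix ι ι ℤ}
    (hA : IsGCM A) (hrc : ∀ i j, r j (c i) = (A i j : ℂ))
    (hS : ∀ i j, ∃ N : ℕ, ((LieAlgebra.ad ℂ (Module.End ℂ W) (D.f i)) ^ N) (D.f j) = 0)
    (hJ : ∀ w : List ι, (∀ i ∈ w, ∀ j ∈ w, i ≠ j → A i j = 0) → D.fWord w v ≠ 0)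
    (w : List ι) : ∃ x ≠ 0, x ∈ weightSubspace D.h (lam - wordWeight r w) := by
  classical
  have hrc2 : ∀ i, r i (c i) = 2 := fun i => by rw [hrc, hA.diag]; norm_num
  induction hn : w.length using Nat.strong_induction_on generalizing w with
  | _ n ih =>
  subst hn
  -- Only `j` must pair with `lam` to a natural number; the neighbour `i` is arbitrary, but must
  -- occur at least as often.
  by_cases h : ∃ j ∈ w, ∃ i ∈ w, i ≠ j ∧ A j i ≠ 0 ∧ w.count j ≤ w.count i ∧
      ∃ m : ℕ, lam (c j) = m
  · obtain ⟨j, hj, i, hi, hij, hji, hcount, m, hm⟩ := h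
    set w' := w.filter (fun k => decide (k ≠ j)) with hw'
    have hjw' : j ∉ w' := by simp [hw']
    have hlen : w'.length < w.length := by
      rw [hw', List.length_filter_lt_length_iff_exists]
      exact ⟨j, hj, by simp⟩
    have hperm : (List.replicate (w.count j) j ++ w').Perm w := by
      rw [List.perm_iff_count]
      intro k
      rw [List.count_append, List.count_replicate]
      by_cases hk : k = j
      · subst hk
        simp [List.count_eq_zero_of_not_mem hjw']
      · rw [hw', List.count_filter (by simpa using hk)]
        simp [Ne.symm hk]
    obtain ⟨x, hx0, hx⟩ := ih _ hlen w' rfl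
    -- Every letter contributes a nonpositive entry, and each copy of the neighbour `i` contributes
    -- at most `-1`.
    have hsum : ∀ l : List ι, j ∉ l → (l.map (A j)).sum ≤ -(l.count i : ℤ) := by
      intro l hl
      induction l with
      | nil => simp
      | cons k l ihl =>
        have h1 := ihl fun h => hl (by simp [h])
        have h2 := hA.nonpos j k fun h => hl (by simp [h])
        rw [List.map_cons, List.sum_cons, List.count_cons]
        by_cases hk : k = i
        · subst hk
          have : A j k ≤ -1 := by omega
          simp; omega
        · simp [hk]; omega
    have hval : ∀ l : List ι, wordWeight r l (c j) = ((l.map (A j)).sum : ℤ) := by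
      intro l
      induction l with
      | nil => simp
      | cons k l ihl => simp [ihl, hrc]
    have hcw' : w'.count i = w.count i := by rw [hw', List.count_filter (by simpa using hij)]
    have hle := hsum w' hjw'
    -- `x` is killed by `e j`, and its `c j`-eigenvalue is at least `m + w.count i ≥ w.count j`, so
    -- no factor in the `sl₂`-string vanishes before all copies of `j` are restored.
    refine ⟨(D.f j ^ w.count j) x, f_pow_ne_zero (hrc2 j) hx0 (mem_weightSubspace.1 hx (c j))
      (H.e_apply_eq_zero hr hjw' hx) _ ?_, ?_⟩
    · intro k hk h
      rw [LinearMap.sub_apply, hm, hval] at h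
      have h2 : (m : ℤ) - (w'.map (A j)).sum = k := by exact_mod_cast h
      omega
    · have := fWord_mem_weightSubspace (List.replicate (w.count j) j) hx
      rw [fWord_replicate_apply] at this
      rwa [← wordWeight_perm hperm, wordWeight_append, add_comm, ← sub_sub]
  · set a := w.filter (fun k => decide (∃ m : ℕ, lam (c k) = m)) with ha
    set b := w.filter (fun k => !decide (∃ m : ℕ, lam (c k) = m)) with hb
    have hperm : (a ++ b).Perm w := List.filter_append_perm _ _
    -- Of two adjacent letters of `a`, the one occurring less often would play the role of `j` in
    -- the previous case.
    have haJ : D.fWord a v ≠ 0 := by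
      refine hJ a fun i hi j hj hij => ?_
      by_contra hne
      have hne' : A j i ≠ 0 := fun h => hne (hA.zero_symm _ _ h)
      simp only [ha, List.mem_filter, decide_eq_true_eq] at hi hj
      push Not at h
      rcases le_total (w.count i) (w.count j) with hle | hle
      · obtain ⟨m, hm⟩ := hi.2
        exact h i hi.1 j hj.1 hij.symm hne hle m hm
      · obtain ⟨m, hm⟩ := hj.2
        exact h j hj.1 i hi.1 hij hne' hle m hm
    have hbr : D.fWord b v ∉ D.rad v := by
      refine H.fWord_notMem_rad hr hrc2 hS fun i hi n hn => ?_
      simp only [hb, List.mem_filter, Bool.not_eq_true', decide_eq_false_iff_not] at hi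
      exact hi.2 ⟨n, hn⟩
    obtain ⟨u, hu, t, ht, htv⟩ := H.exists_eWord_eq hr (H.fWord_mem b) hbr
    refine ⟨D.fWord a (D.fWord b v), fun h0 => ?_, ?_⟩
    -- The letters of `u` are those of `b`, disjoint from those of `a`, so the raising word passes
    -- through `fWord a`.
    · have h1 : D.eWord u (D.fWord a (D.fWord b v)) = t • D.fWord a v := by
        rw [eWord_fWord_comm, htv, map_smul]
        rintro i hi j hj rfl
        have hi' := hu.subset hi
        simp only [ha, hb, List.mem_filter, Bool.not_eq_true', decide_eq_false_iff_not,
          decide_eq_true_eq] at hi' hj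
        exact hi'.2 hj.2
      rw [h0, map_zero] at h1
      exact smul_ne_zero ht haJ h1.symm
    · rw [← wordWeight_perm hperm, ← fWord_append_apply]
      exact H.fWord_mem _

/-- Over pairwise orthogonal simple roots, the weight space is spanned by a single vector. -/
theorem exists_smul_of_pairwise (hr : LinearIndependent ℂ r) {w : List ι}
    (hw : ∀ i ∈ w, ∀ j ∈ w, ⁅D.f i, D.f j⁆ = 0) {x : W}
    (hx : x ∈ weightSubspace D.h (lam - wordWeight r w)) : ∃ t : ℂ, x = t • D.fWord w v := by
  have h1 := mem_span_image_of_mem_weightSubspace H.fWord_mem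
    (H.span_eq_top.ge (Submodule.mem_top (x := x))) hx
  have h2 : (fun u => D.fWord u v) '' {u | lam - wordWeight r u = lam - wordWeight r w} ⊆
      {D.fWord w v} := by
    rintro _ ⟨u, hu, rfl⟩
    have hp : w.Perm u := perm_of_wordWeight_eq hr (sub_right_injective hu).symm
    have : (w.map D.f).prod = (u.map D.f).prod := by
      refine (hp.map D.f).prod_eq' ?_
      refine List.pairwise_of_forall_mem_list fun a ha b hb => ?_
      obtain ⟨i, hi, rfl⟩ := List.mem_map.1 ha
      obtain ⟨j, hj, rfl⟩ := List.mem_map.1 hb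
      exact commute_iff_lie_eq.2 (hw i hi j hj)
    simp [fWord, this]
  obtain ⟨t, ht⟩ := Submodule.mem_span_singleton.1 (Submodule.span_mono h2 h1)
  exact ⟨t, ht.symm⟩

end IsHighestWeight

end Operators

end ChevalleySystem

namespace ChevalleySystem

variable {ι 𝔥 : Type*} [AddCommGroup 𝔥] [Module ℂ 𝔥] {G : Type*} [LieRing G]
    [LieAlgebra ℂ G] {r : ι → Dual ℂ 𝔥} {c : ι → 𝔥} (D : ChevalleySystem G r c)

/-! ### Serre elements and the triangular decomposition. -/

section Serre

theorem lie_h_ad_f_pow (x : 𝔥) (i j : ι) (n : ℕ) :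
    ⁅D.h x, ((LieAlgebra.ad ℂ G (D.f i)) ^ n) (D.f j)⁆ =
      (-(r j x) - n * r i x) • ((LieAlgebra.ad ℂ G (D.f i)) ^ n) (D.f j) := by
  induction n with
  | zero => simp [D.lie_h_f]
  | succ n ih =>
    rw [pow_succ', Module.End.mul_apply, LieAlgebra.ad_apply, leibniz_lie, ih, D.lie_h_f,
      neg_lie, smul_lie, lie_smul, ← neg_smul, ← add_smul]
    congr 1
    push_cast
    ring

theorem lie_e_ad_f_pow_of_ne {i j k : ι} (hi : k ≠ i) (hj : k ≠ j) (n : ℕ) :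
    ⁅D.e k, ((LieAlgebra.ad ℂ G (D.f i)) ^ n) (D.f j)⁆ = 0 := by
  induction n with
  | zero => simp [D.lie_e_f_ne _ _ hj]
  | succ n ih =>
    rw [pow_succ', Module.End.mul_apply, LieAlgebra.ad_apply, leibniz_lie, ih,
      D.lie_e_f_ne _ _ hi]
    simp

theorem lie_e_ad_f_pow_right {i j : ι} (hij : i ≠ j) (n : ℕ) :
    ⁅D.e j, ((LieAlgebra.ad ℂ G (D.f i)) ^ n) (D.f j)⁆ =
      ((LieAlgebra.ad ℂ G (D.f i)) ^ n) (D.h (c j)) := by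
  induction n with
  | zero => simp [D.lie_e_f_same]
  | succ n ih =>
    rw [pow_succ', Module.End.mul_apply, LieAlgebra.ad_apply, leibniz_lie, ih,
      D.lie_e_f_ne _ _ hij.symm, Module.End.mul_apply, LieAlgebra.ad_apply]
    simp

theorem lie_e_ad_f_pow_left {i j : ι} (hij : i ≠ j) (hi : r i (c i) = 2) (n : ℕ) :
    ⁅D.e i, ((LieAlgebra.ad ℂ G (D.f i)) ^ (n + 1)) (D.f j)⁆ =
      ((n + 1 : ℂ) * (-(r j (c i)) - n)) • ((LieAlgebra.ad ℂ G (D.f i)) ^ n) (D.f j) := by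
  induction n with
  | zero => simp [leibniz_lie (D.e i), D.lie_e_f_same, D.lie_e_f_ne _ _ hij, D.lie_h_f]
  | succ n ih =>
    rw [pow_succ', Module.End.mul_apply, LieAlgebra.ad_apply, leibniz_lie, ih, D.lie_e_f_same,
      lie_h_ad_f_pow, lie_smul, ← LieAlgebra.ad_apply ℂ, ← Module.End.mul_apply, ← pow_succ',
      ← add_smul, hi]
    congr 1
    push_cast
    ring

/-- The Serre elements in the `f i` commute with the `e k`. -/
theorem lie_e_serre {A : Matrix ι ι ℤ} (hA : IsGCM A) (hrc : ∀ i j, r j (c i) = (A i j : ℂ))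
    {i j : ι} (hij : i ≠ j) (k : ι) :
    ⁅D.e k, ((LieAlgebra.ad ℂ G (D.f i)) ^ (1 - A i j).toNat) (D.f j)⁆ = 0 := by
  have hneg := hA.nonpos i j hij
  obtain ⟨m, hm⟩ : ∃ m : ℕ, A i j = -m := ⟨(-A i j).toNat, by omega⟩
  have hN : (1 - A i j).toNat = m + 1 := by omega
  rw [hN]
  by_cases hki : k = i
  · subst hki
    -- The Serre exponent `m + 1` is exactly where the factor `-A i j - m` vanishes.
    rw [lie_e_ad_f_pow_left D hij (by rw [hrc, hA.diag]; norm_num), hrc, hm]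
    simp
  by_cases hkj : k = j
  · subst hkj
    rw [lie_e_ad_f_pow_right D hij, pow_succ, Module.End.mul_apply, LieAlgebra.ad_apply,
      ← lie_skew, D.lie_h_f, neg_neg, hrc]
    -- What remains is `(ad f_i) ^ m` applied to a multiple of `f_i`: for `m = 0` the scalar is zero
    -- by symmetry of zeros in `A`, for `m > 0` because `⁅f_i, f_i⁆ = 0`.
    cases m with
    | zero => simp [hA.zero_symm i k (by simpa using hm)]
    | succ m => simp [pow_succ]
  · exact lie_e_ad_f_pow_of_ne D hki hkj _

/-- Exchanging `e` and `f` negates both roots and coroots, which leaves the Cartan matrix unchanged.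
-/
theorem lie_f_serre {A : Matrix ι ι ℤ} (hA : IsGCM A) (hrc : ∀ i j, r j (c i) = (A i j : ℂ))
    {i j : ι} (hij : i ≠ j) (k : ι) :
    ⁅D.f k, ((LieAlgebra.ad ℂ G (D.e i)) ^ (1 - A i j).toNat) (D.e j)⁆ = 0 :=
  D.swap.lie_e_serre hA (by simpa using hrc) hij k

end Serre

section Triangular

/-- Iterated brackets of the `e i`. -/
def eBracket (i : ι) : List ι → G
  | [] => D.e i
  | j :: w => ⁅D.e j, eBracket i w⁆

/-- The span of the iterated brackets of the `e i`. -/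
def upper : Submodule ℂ G := Submodule.span ℂ (Set.range fun p : ι × List ι => D.eBracket p.1 p.2)

/-- `D` generates the Lie algebra. -/
def Generates : Prop := ∀ K : LieSubalgebra ℂ G,
  (∀ i, D.e i ∈ K) → (∀ i, D.f i ∈ K) → (∀ x, D.h x ∈ K) → K = ⊤

variable {D}

theorem e_mem_upper (i : ι) : D.e i ∈ D.upper := Submodule.subset_span ⟨(i, []), rfl⟩

theorem lie_e_mem_upper (i : ι) {x : G} (hx : x ∈ D.upper) : ⁅D.e i, x⁆ ∈ D.upper := by
  induction hx using Submodule.span_induction with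
  | mem x hx =>
    obtain ⟨⟨j, w⟩, rfl⟩ := hx
    exact Submodule.subset_span ⟨(j, i :: w), rfl⟩
  | zero => simp
  | add x y _ _ hx hy => rw [lie_add]; exact add_mem hx hy
  | smul t x _ hx => rw [lie_smul]; exact Submodule.smul_mem _ t hx

theorem lie_h_eBracket (x : 𝔥) (i : ι) (w : List ι) :
    ⁅D.h x, D.eBracket i w⁆ = wordWeight r (i :: w) x • D.eBracket i w := by
  induction w with
  | nil => simp [eBracket, D.lie_h_e]
  | cons j w ih =>
    rw [eBracket, leibniz_lie, ih, D.lie_h_e, smul_lie, lie_smul, ← add_smul]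
    congr 1
    simp
    ring

theorem lie_h_mem_upper (y : 𝔥) {x : G} (hx : x ∈ D.upper) : ⁅D.h y, x⁆ ∈ D.upper := by
  induction hx using Submodule.span_induction with
  | mem x hx =>
    obtain ⟨⟨j, w⟩, rfl⟩ := hx
    dsimp only
    rw [lie_h_eBracket]
    exact Submodule.smul_mem _ _ (Submodule.subset_span ⟨(j, w), rfl⟩)
  | zero => simp
  | add x y _ _ hx hy => rw [lie_add]; exact add_mem hx hy
  | smul t x _ hx => rw [lie_smul]; exact Submodule.smul_mem _ t hx

theorem lie_f_e_mem (i j : ι) : ⁅D.f i, D.e j⁆ ∈ LinearMap.range D.h := by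
  rw [← lie_skew]
  by_cases h : j = i
  · subst h
    rw [D.lie_e_f_same]
    exact neg_mem ⟨_, rfl⟩
  · simp [D.lie_e_f_ne _ _ h]

theorem lie_e_mem_of_mem (i : ι) {x : G} (hx : x ∈ D.upper ⊔ LinearMap.range D.h) :
    ⁅D.e i, x⁆ ∈ D.upper := by
  obtain ⟨y, hy, _, ⟨z, rfl⟩, rfl⟩ := Submodule.mem_sup.1 hx
  rw [lie_add, ← lie_skew _ (D.h z), D.lie_h_e]
  exact add_mem (lie_e_mem_upper i hy) (neg_mem (Submodule.smul_mem _ _ (e_mem_upper i)))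

theorem lie_f_mem_of_mem_upper (i : ι) {x : G} (hx : x ∈ D.upper) :
    ⁅D.f i, x⁆ ∈ D.upper ⊔ LinearMap.range D.h := by
  induction hx using Submodule.span_induction with
  | mem x hx =>
    obtain ⟨⟨j, w⟩, rfl⟩ := hx
    dsimp only
    induction w with
    | nil => exact Submodule.mem_sup_right (lie_f_e_mem i j)
    | cons k w ih =>
      rw [eBracket, leibniz_lie]
      refine add_mem (Submodule.mem_sup_left ?_) (Submodule.mem_sup_left (lie_e_mem_of_mem k ih))
      obtain ⟨z, hz⟩ := lie_f_e_mem (D := D) i k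
      rw [← hz]
      exact lie_h_mem_upper z (Submodule.subset_span ⟨(j, w), rfl⟩)
  | zero => simp
  | add x y _ _ hx hy => rw [lie_add]; exact add_mem hx hy
  | smul t x _ hx => rw [lie_smul]; exact Submodule.smul_mem _ t hx

/-- The elements whose bracket preserves the sum of the three pieces form a subalgebra containing
the generators, hence everything. The sum is therefore itself a subalgebra containing the
generators. Directness is not needed. -/
theorem exists_triangular (hD : D.Generates) (x : G) :
    ∃ p ∈ D.upper, ∃ y : 𝔥, ∃ n ∈ D.swap.upper, x = p + D.h y + n := by
  let T : Submodule ℂ G := D.upper ⊔ LinearMap.range D.h ⊔ D.swap.upper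
  have hu : D.upper ⊔ LinearMap.range D.h ≤ T := le_sup_left
  have hl : D.swap.upper ⊔ LinearMap.range D.h ≤ T :=
    sup_le le_sup_right (le_sup_right.trans hu)
  have hh : LinearMap.range D.h ≤ T := le_sup_right.trans hu
  have hT : ∀ {y : G}, y ∈ T → ∃ p ∈ D.upper, ∃ z : 𝔥, ∃ n ∈ D.swap.upper,
      y = p + D.h z + n := by
    intro y hy
    change y ∈ D.upper ⊔ LinearMap.range D.h ⊔ D.swap.upper at hy
    obtain ⟨q, hq, n, hn, rfl⟩ := Submodule.mem_sup.1 hy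
    obtain ⟨p, hp, _, ⟨z, rfl⟩, rfl⟩ := Submodule.mem_sup.1 hq
    exact ⟨p, hp, z, n, hn, rfl⟩
  have he : ∀ i, D.e i ∈ T := fun i => hu (Submodule.mem_sup_left (e_mem_upper i))
  have hf : ∀ i, D.f i ∈ T := fun i => hl (Submodule.mem_sup_left (e_mem_upper (D := D.swap) i))
  have hstab : ∀ y t : G, t ∈ T → ⁅y, t⁆ ∈ T := by
    let K : LieSubalgebra ℂ G :=
      { carrier := {y | ∀ t ∈ T, ⁅y, t⁆ ∈ T}
        add_mem' := fun ha hb t ht => by rw [add_lie]; exact add_mem (ha t ht) (hb t ht)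
        zero_mem' := fun t _ => by simp
        smul_mem' := fun a x hx t ht => by rw [smul_lie]; exact T.smul_mem a (hx t ht)
        lie_mem' := fun {x y} hx hy t ht => by
          rw [lie_lie]
          exact sub_mem (hx _ (hy _ ht)) (hy _ (hx _ ht)) }
    have hK : K = ⊤ := by
      refine hD K (fun i t ht => ?_) (fun i t ht => ?_) (fun z t ht => ?_) <;>
        obtain ⟨p, hp, y, n, hn, rfl⟩ := hT ht <;> rw [lie_add, lie_add]
      · refine add_mem (add_mem ?_ ?_) ?_
        · exact hu (Submodule.mem_sup_left (lie_e_mem_upper i hp))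
        · exact hu (Submodule.mem_sup_left (lie_e_mem_of_mem i (Submodule.mem_sup_right ⟨y, rfl⟩)))
        · exact hl (lie_f_mem_of_mem_upper (D := D.swap) i hn)
      · refine add_mem (add_mem ?_ ?_) ?_
        · exact hu (lie_f_mem_of_mem_upper i hp)
        · exact hl (Submodule.mem_sup_left
            (lie_e_mem_of_mem (D := D.swap) i (Submodule.mem_sup_right ⟨y, rfl⟩)))
        · exact hl (Submodule.mem_sup_left (lie_e_mem_upper (D := D.swap) i hn))
      · refine add_mem (add_mem ?_ ?_) ?_
        · exact hu (Submodule.mem_sup_left (lie_h_mem_upper z hp))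
        · simp [D.lie_h_h]
        · exact hl (Submodule.mem_sup_left (lie_h_mem_upper (D := D.swap) z hn))
    intro y
    exact (hK.ge (LieSubalgebra.mem_top y) : y ∈ K)
  have hTop : ({ T with lie_mem' := fun {x y} _ hy => hstab x y hy } : LieSubalgebra ℂ G) = ⊤ :=
    hD _ he hf fun y => hh ⟨y, rfl⟩
  exact hT (hTop.ge (LieSubalgebra.mem_top x) : x ∈ T)

theorem upper_le_otherWeights (hr : LinearIndependent ℂ r) :
    D.upper ≤ otherWeights (fun x => LieAlgebra.ad ℂ G (D.h x)) 0 := by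
  rw [upper, Submodule.span_le]
  rintro _ ⟨⟨i, w⟩, rfl⟩
  refine weightSubspace_le_otherWeights (ν := wordWeight r (i :: w))
    (fun h => ?_) (mem_weightSubspace.2 fun x => ?_)
  · simpa using wordWeight_eq_zero hr h
  · exact lie_h_eBracket x i w

/-- Ideals are graded, so the component in the image of `𝔥` of an element of an ideal lies in the
ideal. -/
theorem h_mem_of_mem_ideal (hr : LinearIndependent ℂ r) (I : LieIdeal ℂ G) {p n : G} {y : 𝔥}
    (hp : p ∈ D.upper) (hn : n ∈ D.swap.upper) (h : p + D.h y + n ∈ I) : D.h y ∈ I := by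
  have hr' : LinearIndependent ℂ (-r) := by
    have := hr.units_smul (fun _ => (-1 : ℂˣ))
    convert this using 1
    ext i
    simp
  -- `D.h y` has weight zero under the adjoint action, while `p` and `n` are sums of vectors of
  -- nonzero weight.
  refine mem_of_add_mem (T := fun x => LieAlgebra.ad ℂ G (D.h x)) (K := I.toSubmodule) (μ := 0)
    (y := p + n) (fun x w hw => lie_mem_right ℂ G I _ _ hw) ?_ ?_ ?_
  · rw [mem_weightSubspace]
    intro x
    simp [D.lie_h_h]
  · exact add_mem (upper_le_otherWeights hr hp) (upper_le_otherWeights (D := D.swap) hr' hn)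
  · rw [show D.h y + (p + n) = p + D.h y + n by abel]
    exact h

end Triangular

end ChevalleySystem

namespace ChevalleySystem

/-! ### Quotients of highest weight spaces, and the Serre relations on the simple one. -/

section Quotient

variable {ι 𝔥 : Type*} [AddCommGroup 𝔥] [Module ℂ 𝔥]
  {W : Type*} [AddCommGroup W] [Module ℂ W] {r : ι → Dual ℂ 𝔥} {c : ι → 𝔥}

/-- A Chevalley system of operators from relations on vectors. -/
def ofApply (e f : ι → Module.End ℂ W) (h : 𝔥 →ₗ[ℂ] Module.End ℂ W)
    (hh : ∀ x y w, h x (h y w) = h y (h x w))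
    (he : ∀ x i w, h x (e i w) = e i (h x w) + r i x • e i w)
    (hf : ∀ x i w, h x (f i w) = f i (h x w) - r i x • f i w)
    (hef : ∀ i w, e i (f i w) = f i (e i w) + h (c i) w)
    (hne : ∀ i j, i ≠ j → ∀ w, e i (f j w) = f j (e i w)) :
    ChevalleySystem (Module.End ℂ W) r c where
  e := e
  f := f
  h := h
  lie_h_h x y := by
    ext w
    simp [LieRing.of_associative_ring_bracket, hh x y]
  lie_h_e x i := by
    ext w
    simp [LieRing.of_associative_ring_bracket, he]
  lie_h_f x i := by
    ext w
    simp [LieRing.of_associative_ring_bracket, hf]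
  lie_e_f_same i := by
    ext w
    simp [LieRing.of_associative_ring_bracket, hef]
  lie_e_f_ne i j hij := by
    ext w
    simp [LieRing.of_associative_ring_bracket, hne i j hij]

variable (D : ChevalleySystem (Module.End ℂ W) r c)

theorem h_h_apply (x y : 𝔥) (w : W) : D.h x (D.h y w) = D.h y (D.h x w) := by
  have := LinearMap.congr_fun (D.lie_h_h x y) w
  rw [LieRing.of_associative_ring_bracket] at this
  simpa only [LinearMap.sub_apply, Module.End.mul_apply, LinearMap.zero_apply, sub_eq_zero]
    using this

/-- The operators induced on the quotient by a stable subspace. -/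
def quot (K : Submodule ℂ W) (hK : D.IsStable K) :
    ChevalleySystem (Module.End ℂ (W ⧸ K)) r c :=
  ofApply (fun i => K.mapQ K (D.e i) (hK.e_mem i)) (fun i => K.mapQ K (D.f i) (hK.f_mem i))
    { toFun := fun x => K.mapQ K (D.h x) (hK.h_mem x)
      map_add' := fun x y => by ext w; simp
      map_smul' := fun t x => by ext w; simp }
    (by
      intro x y w
      obtain ⟨w, rfl⟩ := K.mkQ_surjective w
      simp [D.h_h_apply x y])
    (by
      intro x i w
      obtain ⟨w, rfl⟩ := K.mkQ_surjective w
      simp [D.h_e_apply])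
    (by
      intro x i w
      obtain ⟨w, rfl⟩ := K.mkQ_surjective w
      simp [D.h_f_apply])
    (by
      intro i w
      obtain ⟨w, rfl⟩ := K.mkQ_surjective w
      simp [D.e_f_apply_same])
    (by
      intro i j hij w
      obtain ⟨w, rfl⟩ := K.mkQ_surjective w
      simp [D.e_f_apply_ne hij])

variable {D} {W' : Type*} [AddCommGroup W'] [Module ℂ W']
  {D' : ChevalleySystem (Module.End ℂ W') r c} {p : W →ₗ[ℂ] W'}

theorem map_fWord (hf : ∀ i w, p (D.f i w) = D'.f i (p w)) (u : List ι) (w : W) :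
    p (D.fWord u w) = D'.fWord u (p w) := by
  induction u with
  | nil => simp
  | cons i u ih => simp [hf, ih]

theorem map_eWord (he : ∀ i w, p (D.e i w) = D'.e i (p w)) (u : List ι) (w : W) :
    p (D.eWord u w) = D'.eWord u (p w) := by
  induction u with
  | nil => simp
  | cons i u ih => simp [he, ih]

theorem map_mem_weightSubspace (hh : ∀ x w, p (D.h x w) = D'.h x (p w)) {μ : Dual ℂ 𝔥} {w : W}
    (hw : w ∈ weightSubspace D.h μ) : p w ∈ weightSubspace D'.h μ := by
  rw [mem_weightSubspace] at hw ⊢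
  intro x
  rw [← hh, hw, map_smul]

theorem IsHighestWeight.map {lam : Dual ℂ 𝔥} {v : W} (H : D.IsHighestWeight lam v)
    (he : ∀ i w, p (D.e i w) = D'.e i (p w)) (hf : ∀ i w, p (D.f i w) = D'.f i (p w))
    (hh : ∀ x w, p (D.h x w) = D'.h x (p w)) (hp : Function.Surjective p) (hv : p v ≠ 0) :
    D'.IsHighestWeight lam (p v) where
  ne_zero := hv
  e_apply i := by rw [← he, H.e_apply, map_zero]
  mem_weight := map_mem_weightSubspace hh H.mem_weight
  span_eq_top := by
    have := congr_arg (Submodule.map p) H.span_eq_top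
    rw [Submodule.map_span, Submodule.map_top, LinearMap.range_eq_top.2 hp,
      ← Set.range_comp] at this
    rw [← this]
    congr 2
    ext u
    simp [map_fWord hf]

theorem isHighestWeight_quot_rad (hr : LinearIndependent ℂ r) {lam : Dual ℂ 𝔥} {v : W}
    (H : D.IsHighestWeight lam v) :
    (D.quot (D.rad v) H.isStable_rad).IsHighestWeight lam ((D.rad v).mkQ v) :=
  H.map (fun _ _ => rfl) (fun _ _ => rfl) (fun _ _ => rfl) (Submodule.mkQ_surjective _)
    (by simpa using H.notMem_rad hr)

/-- As `rad v ≤ lower v`, membership in `lower` can be tested in the quotient, so a vector whose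
class is in the radical was already in `rad v`. -/
theorem rad_quot_rad {lam : Dual ℂ 𝔥} {v : W}
    (H : D.IsHighestWeight lam v) :
    (D.quot (D.rad v) H.isStable_rad).rad ((D.rad v).mkQ v) = ⊥ := by
  rw [eq_bot_iff]
  intro x hx
  obtain ⟨x, rfl⟩ := Submodule.mkQ_surjective _ x
  rw [Submodule.mem_bot, Submodule.mkQ_apply, Submodule.Quotient.mk_eq_zero, mem_rad]
  intro u
  have h1 := mem_rad.1 hx u
  rw [← map_eWord (p := (D.rad v).mkQ) (D := D) (fun _ _ => rfl)] at h1
  have h2 : (D.quot (D.rad v) H.isStable_rad).lower ((D.rad v).mkQ v) =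
      (D.lower v).map (D.rad v).mkQ := by
    rw [lower, lower, Submodule.map_span, ← Set.range_comp]
    congr 2
    funext u
    exact (map_fWord (p := (D.rad v).mkQ) (D := D)
      (D' := D.quot (D.rad v) H.isStable_rad) (fun _ _ => rfl) u v).symm
  rw [h2] at h1
  obtain ⟨y, hy, hyx⟩ := h1
  have h3 := rad_le_lower ((Submodule.Quotient.eq _).1 hyx)
  rw [← sub_sub_cancel y (D.eWord u x)]
  exact sub_mem hy h3

section Serre

variable {lam : Dual ℂ 𝔥} {v : W} (H : D.IsHighestWeight lam v)
include H

theorem IsHighestWeight.ad_f_pow_mem_lower (i j : ι) (n : ℕ) (x : W) :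
    ((LieAlgebra.ad ℂ (Module.End ℂ W) (D.f i)) ^ n) (D.f j) x ∈ D.lower v := by
  induction n generalizing x with
  | zero => exact H.f_mem_lower j x
  | succ n ih =>
    simp only [pow_succ', Module.End.mul_apply, LieAlgebra.ad_apply,
      LieRing.of_associative_ring_bracket, LinearMap.sub_apply]
    exact sub_mem (H.f_mem_lower i _) (ih _)

theorem IsHighestWeight.ad_e_pow_apply (i j : ι) (n : ℕ) :
    ((LieAlgebra.ad ℂ (Module.End ℂ W) (D.e i)) ^ n) (D.e j) v = 0 := by
  induction n with
  | zero => exact H.e_apply j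
  | succ n ih =>
    simp only [pow_succ', Module.End.mul_apply, LieAlgebra.ad_apply,
      LieRing.of_associative_ring_bracket, LinearMap.sub_apply, ih, H.e_apply, map_zero, sub_zero]

/-- The Serre element commutes with every `e k`, so raising its image gives again an image of it,
and those lie in `lower v`. -/
theorem IsHighestWeight.serre_f_mem_rad {A : Matrix ι ι ℤ} (hA : IsGCM A)
    (hrc : ∀ i j, r j (c i) = (A i j : ℂ)) {i j : ι} (hij : i ≠ j) (x : W) :
    ((LieAlgebra.ad ℂ (Module.End ℂ W) (D.f i)) ^ (1 - A i j).toNat) (D.f j) x ∈ D.rad v := by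
  rw [mem_rad]
  intro u
  have : D.eWord u
      (((LieAlgebra.ad ℂ (Module.End ℂ W) (D.f i)) ^ (1 - A i j).toNat) (D.f j) x) =
      ((LieAlgebra.ad ℂ (Module.End ℂ W) (D.f i)) ^ (1 - A i j).toNat) (D.f j)
        (D.eWord u x) := by
    induction u with
    | nil => simp
    | cons k u ih =>
      rw [eWord_cons_apply, ih, eWord_cons_apply]
      have := LinearMap.congr_fun (D.lie_e_serre hA hrc hij k) (D.eWord u x)
      rwa [LieRing.of_associative_ring_bracket, LinearMap.sub_apply, LinearMap.zero_apply,
        sub_eq_zero] at this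
  rw [this]
  exact H.ad_f_pow_mem_lower i j _ _

/-- The element kills `v` and commutes with every `f k`, so it kills all the monomials spanning the
space. -/
theorem IsHighestWeight.serre_e_eq_zero {A : Matrix ι ι ℤ} (hA : IsGCM A)
    (hrc : ∀ i j, r j (c i) = (A i j : ℂ)) {i j : ι} (hij : i ≠ j) :
    ((LieAlgebra.ad ℂ (Module.End ℂ W) (D.e i)) ^ (1 - A i j).toNat) (D.e j) = 0 := by
  refine LinearMap.ext_on_range H.span_eq_top fun w => ?_
  induction w with
  | nil => exact H.ad_e_pow_apply i j _
  | cons k w ih =>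
    have := LinearMap.congr_fun (D.lie_f_serre hA hrc hij k) (D.fWord w v)
    rw [LieRing.of_associative_ring_bracket, LinearMap.sub_apply, LinearMap.zero_apply,
      Module.End.mul_apply, ih, LinearMap.zero_apply, map_zero, zero_sub, neg_eq_zero] at this
    simpa using this

end Serre

end Quotient

/-! ### The highest weight module with basis the words. -/

section WordModule

variable {ι 𝔥 : Type*} [DecidableEq ι] [AddCommGroup 𝔥] [Module ℂ 𝔥] (r : ι → Dual ℂ 𝔥)
  (c : ι → 𝔥) (lam : Dual ℂ 𝔥)

/-- Left multiplication by a letter on the space with basis the words. -/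
def wordF (i : ι) : Module.End ℂ (List ι →₀ ℂ) := Finsupp.lmapDomain ℂ ℂ (List.cons i)

omit [DecidableEq ι] in
theorem wordF_single (i : ι) (w : List ι) :
    wordF i (Finsupp.single w 1) = Finsupp.single (i :: w) 1 := by
  simp [wordF]

/-- The diagonal operator with eigenvalue `(lam - wordWeight r w) x` on the word `w`. -/
def wordH : 𝔥 →ₗ[ℂ] Module.End ℂ (List ι →₀ ℂ) where
  toFun x := Finsupp.linearCombination ℂ fun w => (lam - wordWeight r w) x • Finsupp.single w 1
  map_add' x y := by
    refine Finsupp.lhom_ext' fun w => LinearMap.ext_ring ?_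
    simp only [LinearMap.comp_apply, Finsupp.lsingle_apply, Finsupp.linearCombination_single,
      LinearMap.add_apply, map_add, add_smul, one_smul]
  map_smul' t x := by
    refine Finsupp.lhom_ext' fun w => LinearMap.ext_ring ?_
    simp only [LinearMap.comp_apply, Finsupp.lsingle_apply, Finsupp.linearCombination_single,
      LinearMap.smul_apply, map_smul, one_smul, smul_assoc, RingHom.id_apply]

omit [DecidableEq ι] in
theorem wordH_single (x : 𝔥) (w : List ι) :
    wordH r lam x (Finsupp.single w 1) = (lam - wordWeight r w) x • Finsupp.single w 1 := by
  simp only [wordH, LinearMap.coe_mk, AddHom.coe_mk, Finsupp.linearCombination_single, one_smul]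

/-- The image of a word under `e i`, by commuting `e i` to the right. -/
def wordEAux (i : ι) : List ι → (List ι →₀ ℂ)
  | [] => 0
  | j :: w => wordF j (wordEAux i w) +
      if i = j then (lam - wordWeight r w) (c i) • Finsupp.single w 1 else 0

/-- The raising operators on the space of words. -/
def wordE (i : ι) : Module.End ℂ (List ι →₀ ℂ) := Finsupp.linearCombination ℂ (wordEAux r c lam i)

theorem wordE_single (i : ι) (w : List ι) :
    wordE r c lam i (Finsupp.single w 1) = wordEAux r c lam i w := by
  simp [wordE]

omit [DecidableEq ι] in
theorem word_induction {P Q : (List ι →₀ ℂ) →ₗ[ℂ] (List ι →₀ ℂ)}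
    (h : ∀ w, P (Finsupp.single w 1) = Q (Finsupp.single w 1)) (x : List ι →₀ ℂ) : P x = Q x :=
  LinearMap.congr_fun (Finsupp.lhom_ext' fun w => LinearMap.ext_ring (h w)) x

omit [DecidableEq ι] in
theorem wordH_wordF (x : 𝔥) (i : ι) (w : List ι →₀ ℂ) :
    wordH r lam x (wordF i w) = wordF i (wordH r lam x w) - r i x • wordF i w := by
  refine word_induction (P := wordH r lam x ∘ₗ wordF i)
    (Q := wordF i ∘ₗ wordH r lam x - r i x • wordF i) (fun w => ?_) w
  change wordH r lam x (wordF i (Finsupp.single w 1)) =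
    wordF i (wordH r lam x (Finsupp.single w 1)) - r i x • wordF i (Finsupp.single w 1)
  rw [wordF_single, wordH_single, wordH_single, map_smul, wordF_single, ← sub_smul]
  congr 1
  simp
  ring

theorem wordH_wordEAux (x : 𝔥) (i : ι) (w : List ι) :
    wordH r lam x (wordEAux r c lam i w) =
      ((lam - wordWeight r w) x + r i x) • wordEAux r c lam i w := by
  induction w with
  | nil => simp [wordEAux]
  | cons j w ih =>
    rw [wordEAux, map_add, wordH_wordF, ih, map_smul, ← sub_smul, smul_add]
    congr 1
    · congr 1
      simp
      ring
    · split_ifs with h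
      · subst h
        rw [map_smul, wordH_single, smul_comm]
        congr 1
        simp
        ring
      · simp

/-- The Verma module without Serre relations, on the space with basis the words. -/
def wordSystem : ChevalleySystem (Module.End ℂ (List ι →₀ ℂ)) r c :=
  ofApply (wordE r c lam) wordF (wordH r lam)
    (fun x y => word_induction (P := wordH r lam x ∘ₗ wordH r lam y)
      (Q := wordH r lam y ∘ₗ wordH r lam x) fun w => by
        simp only [LinearMap.comp_apply, wordH_single, map_smul]
        rw [smul_comm])
    (fun x i => word_induction (P := wordH r lam x ∘ₗ wordE r c lam i)
      (Q := wordE r c lam i ∘ₗ wordH r lam x + r i x • wordE r c lam i) fun w => by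
        simp only [LinearMap.comp_apply, LinearMap.add_apply, LinearMap.smul_apply, wordH_single,
          map_smul, wordE_single, wordH_wordEAux, add_smul])
    (wordH_wordF r lam)
    (fun i => word_induction (P := wordE r c lam i ∘ₗ wordF i)
      (Q := wordF i ∘ₗ wordE r c lam i + wordH r lam (c i)) fun w => by
        simp [wordF_single, wordE_single, wordH_single, wordEAux, -LinearMap.sub_apply])
    (fun i j hij => word_induction (P := wordE r c lam i ∘ₗ wordF j)
      (Q := wordF j ∘ₗ wordE r c lam i) fun w => by
        simp [wordF_single, wordE_single, wordEAux, hij])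

theorem fWord_wordSystem (w : List ι) :
    (wordSystem r c lam).fWord w (Finsupp.single [] 1) = Finsupp.single w 1 := by
  induction w with
  | nil => rfl
  | cons i w ih =>
    rw [fWord_cons_apply, ih]
    exact wordF_single i w

theorem isHighestWeight_wordSystem :
    (wordSystem r c lam).IsHighestWeight lam (Finsupp.single [] 1) where
  ne_zero := by simp
  e_apply i := wordE_single r c lam i []
  mem_weight := mem_weightSubspace.2 fun x => by
    have := wordH_single r lam x []
    rw [wordWeight_nil, sub_zero] at this
    exact this
  span_eq_top := by
    rw [eq_top_iff]
    rintro x -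
    induction x using Finsupp.induction_linear with
    | zero => exact zero_mem _
    | add x y hx hy => exact add_mem hx hy
    | single w t =>
      rw [← mul_one t, ← smul_eq_mul, ← Finsupp.smul_single]
      exact Submodule.smul_mem _ _ (Submodule.subset_span ⟨w, fWord_wordSystem r c lam w⟩)

end WordModule

end ChevalleySystem

/-! ### Quotient Lie algebras and generation of free Lie algebras. -/

section LieQuotient

variable {L L' : Type*} [LieRing L] [LieAlgebra ℂ L] [LieRing L'] [LieAlgebra ℂ L']

/-- The quotient map by an ideal, as a homomorphism of Lie algebras. -/
def lieQuotMk (I : LieIdeal ℂ L) : L →ₗ⁅ℂ⁆ L ⧸ I :=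
  { (LieSubmodule.Quotient.mk' I : L →ₗ[ℂ] L ⧸ I) with
    map_lie' := fun {x y} => LieSubmodule.Quotient.mk_bracket I x y }

theorem lieQuotMk_surjective (I : LieIdeal ℂ L) : Function.Surjective (lieQuotMk I) :=
  LieSubmodule.Quotient.surjective_mk' I

theorem lieQuotMk_eq_zero {I : LieIdeal ℂ L} {x : L} : lieQuotMk I x = 0 ↔ x ∈ I :=
  LieSubmodule.Quotient.mk_eq_zero I

/-- The homomorphism induced on the quotient by an ideal contained in the kernel. -/
def lieQuotLift (I : LieIdeal ℂ L) (φ : L →ₗ⁅ℂ⁆ L') (h : I ≤ φ.ker) : L ⧸ I →ₗ⁅ℂ⁆ L' :=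
  { I.toSubmodule.liftQ (φ : L →ₗ[ℂ] L') (fun x hx => h hx) with
    map_lie' := fun {x y} => by
      obtain ⟨x, rfl⟩ := lieQuotMk_surjective I x
      obtain ⟨y, rfl⟩ := lieQuotMk_surjective I y
      rw [← LieHom.map_lie]
      exact φ.map_lie x y }

theorem map_ad_pow (φ : L →ₗ⁅ℂ⁆ L') (x y : L) (n : ℕ) :
    φ (((LieAlgebra.ad ℂ L x) ^ n) y) = ((LieAlgebra.ad ℂ L' (φ x)) ^ n) (φ y) := by
  induction n with
  | zero => rfl
  | succ n ih => rw [pow_succ', pow_succ', Module.End.mul_apply, Module.End.mul_apply,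
      LieAlgebra.ad_apply, LieAlgebra.ad_apply, LieHom.map_lie, ih]

theorem freeLie_eq_top {X : Type*} (K : LieSubalgebra ℂ (FreeLieAlgebra ℂ X))
    (h : ∀ x, FreeLieAlgebra.of ℂ x ∈ K) : K = ⊤ := by
  have h1 : K.incl.comp (FreeLieAlgebra.lift ℂ fun x => (⟨_, h x⟩ : K)) = LieHom.id := by
    refine FreeLieAlgebra.hom_ext fun x => ?_
    simp
  rw [eq_top_iff]
  intro x _
  have h2 := LieHom.congr_fun h1 x
  rw [LieHom.comp_apply, LieHom.id_apply] at h2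
  rw [← h2]
  exact Subtype.property _

end LieQuotient

/-! ### The generators of `ḡ(A)` and `𝔤(A)`, and the simple highest weight modules. -/

section System

variable {ι : Type*} [Fintype ι] {A : Matrix ι ι ℤ}
  {𝔥 : Type*} [AddCommGroup 𝔥] [Module ℂ 𝔥] (R : Realization A 𝔥)

variable {R} in
theorem relQuot_eq_zero {x : FreeLie ι 𝔥} (h : Rel R x) : lieQuotMk (relIdeal R) x = 0 :=
  lieQuotMk_eq_zero.2 (LieSubmodule.subset_lieSpan h)

/-- The generators of `ḡ(A)`. -/
def gBarSystem : ChevalleySystem (gBar R) R.root R.coroot where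
  e i := lieQuotMk (relIdeal R) (freeE ι 𝔥 i)
  f i := lieQuotMk (relIdeal R) (freeF ι 𝔥 i)
  h :=
    { toFun := fun x => lieQuotMk (relIdeal R) (freeH ι x)
      map_add' := fun x y => by
        simpa [sub_eq_zero] using relQuot_eq_zero (Rel.add (R := R) x y)
      map_smul' := fun t x => by
        simpa [sub_eq_zero] using relQuot_eq_zero (Rel.smul (R := R) t x) }
  lie_h_h x y := by simpa using relQuot_eq_zero (Rel.hh (R := R) x y)
  lie_h_e x i := by simpa [sub_eq_zero] using relQuot_eq_zero (Rel.he (R := R) x i)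
  lie_h_f x i := by simpa [add_eq_zero_iff_eq_neg] using relQuot_eq_zero (Rel.hf (R := R) x i)
  lie_e_f_same i := by simpa [sub_eq_zero] using relQuot_eq_zero (Rel.ef_same (R := R) i)
  lie_e_f_ne i j h := by simpa using relQuot_eq_zero (Rel.ef_ne (R := R) i j h)

theorem gBarSystem_generates : (gBarSystem R).Generates := by
  intro K he hf hh
  have h1 : K.comap (lieQuotMk (relIdeal R)) = ⊤ := by
    refine freeLie_eq_top _ fun x => ?_
    cases x with
    | e i => exact he i
    | f i => exact hf i
    | h x => exact hh x
  rw [eq_top_iff]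
  intro x _
  obtain ⟨x, rfl⟩ := lieQuotMk_surjective _ x
  exact h1.ge (LieSubalgebra.mem_top x)

/-- The generators of `𝔤(A)`. -/
def kmSystem : ChevalleySystem (KM R) R.root R.coroot :=
  (gBarSystem R).map (lieQuotMk (radIdeal R) : gBar R →ₗ⁅ℂ⁆ KM R)

theorem kmSystem_generates : (kmSystem R).Generates := by
  intro K he hf hh
  have h1 : K.comap (lieQuotMk (radIdeal R) : gBar R →ₗ⁅ℂ⁆ KM R) = ⊤ :=
    gBarSystem_generates R _ he hf hh
  rw [eq_top_iff]
  intro x _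
  obtain ⟨x, rfl⟩ := lieQuotMk_surjective (radIdeal R) x
  exact h1.ge (LieSubalgebra.mem_top x)

theorem kmSystem_ad_f_nilpotent (i j : ι) :
    ∃ N : ℕ, ((LieAlgebra.ad ℂ (KM R) ((kmSystem R).f i)) ^ N) ((kmSystem R).f j) = 0 := by
  by_cases hij : i = j
  · subst hij
    exact ⟨1, by simp⟩
  · refine ⟨(1 - A i j).toNat, ?_⟩
    have h := relQuot_eq_zero (Rel.serre_f (R := R) i j hij)
    rw [map_ad_pow] at h
    have h2 := congr_arg (lieQuotMk (radIdeal R)) h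
    rw [map_ad_pow, map_zero] at h2
    exact h2

/-- For `A i j = 0` the Serre exponent is `1`, and the relation is the bracket itself. -/
theorem kmSystem_lie_f_f {i j : ι} (h : i ≠ j → A i j = 0) :
    ⁅(kmSystem R).f i, (kmSystem R).f j⁆ = 0 := by
  by_cases hij : i = j
  · subst hij
    simp
  · have h1 := relQuot_eq_zero (Rel.serre_f (R := R) i j hij)
    rw [h hij] at h1
    have h2 := congr_arg (lieQuotMk (radIdeal R)) h1
    rw [map_zero] at h2
    refine Eq.trans ?_ h2
    simp only [sub_zero, Int.toNat_one, pow_one, LieAlgebra.ad_apply, LieHom.map_lie]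
    rfl

variable {R}

/-- A Chevalley system satisfying the Serre relations gives a homomorphism from `ḡ(A)`. -/
theorem exists_gBar_hom {G : Type*} [LieRing G] [LieAlgebra ℂ G]
    (D : ChevalleySystem G R.root R.coroot)
    (he : ∀ i j, i ≠ j → ((LieAlgebra.ad ℂ G (D.e i)) ^ (1 - A i j).toNat) (D.e j) = 0)
    (hf : ∀ i j, i ≠ j → ((LieAlgebra.ad ℂ G (D.f i)) ^ (1 - A i j).toNat) (D.f j) = 0) :
    ∃ φ : gBar R →ₗ⁅ℂ⁆ G, (gBarSystem R).map φ = D := by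
  let ψ : FreeLie ι 𝔥 →ₗ⁅ℂ⁆ G := FreeLieAlgebra.lift ℂ fun
    | .e i => D.e i
    | .f i => D.f i
    | .h x => D.h x
  have ψe : ∀ i, ψ (freeE ι 𝔥 i) = D.e i := fun i => FreeLieAlgebra.lift_of_apply ..
  have ψf : ∀ i, ψ (freeF ι 𝔥 i) = D.f i := fun i => FreeLieAlgebra.lift_of_apply ..
  have ψh : ∀ x, ψ (freeH ι x) = D.h x := fun x => FreeLieAlgebra.lift_of_apply ..
  have hker : relIdeal R ≤ ψ.ker := by
    rw [relIdeal, LieSubmodule.lieSpan_le]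
    intro x hx
    rw [SetLike.mem_coe, LieHom.mem_ker]
    cases (hx : Rel R x) with
    | add x y => simp only [map_sub, map_add, ψh, sub_self]
    | smul t x => simp only [map_sub, map_smul, ψh, sub_self]
    | hh x y => rw [LieHom.map_lie, ψh, ψh, D.lie_h_h]
    | he x i => rw [map_sub, LieHom.map_lie, map_smul, ψh, ψe, D.lie_h_e, sub_self]
    | hf x i =>
      rw [map_add, LieHom.map_lie, map_smul, ψh, ψf, D.lie_h_f, neg_add_cancel]
    | ef_same i => rw [map_sub, LieHom.map_lie, ψh, ψe, ψf, D.lie_e_f_same, sub_self]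
    | ef_ne i j h => rw [LieHom.map_lie, ψe, ψf, D.lie_e_f_ne _ _ h]
    | serre_e i j h => rw [map_ad_pow, ψe, ψe, he i j h]
    | serre_f i j h => rw [map_ad_pow, ψf, ψf, hf i j h]
  refine ⟨lieQuotLift _ ψ hker, ?_⟩
  cases D
  simp only [ChevalleySystem.map, ChevalleySystem.mk.injEq]
  exact ⟨funext ψe, funext ψf, LinearMap.ext ψh⟩

section Radical

variable {W : Type*} [AddCommGroup W] [Module ℂ W] {φ : gBar R →ₗ⁅ℂ⁆ Module.End ℂ W}
  {lam : Dual ℂ 𝔥} {v : W}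

theorem lie_apply {L : Type*} [LieRing L] [LieAlgebra ℂ L] (φ : L →ₗ⁅ℂ⁆ Module.End ℂ W)
    (x y : L) (w : W) : φ ⁅x, y⁆ w = φ x (φ y w) - φ y (φ x w) := by
  rw [LieHom.map_lie, LieRing.of_associative_ring_bracket]
  rfl

theorem upper_apply (H : ((gBarSystem R).map φ).IsHighestWeight lam v) {p : gBar R}
    (hp : p ∈ (gBarSystem R).upper) : φ p v = 0 := by
  induction hp using Submodule.span_induction with
  | mem x hx =>
    obtain ⟨⟨i, w⟩, rfl⟩ := hx
    induction w with
    | nil => exact H.e_apply i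
    | cons j w ih =>
      have h1 : φ ((gBarSystem R).e j) v = 0 := H.e_apply j
      have h2 : φ ((gBarSystem R).eBracket i w) v = 0 := ih
      dsimp only
      rw [ChevalleySystem.eBracket, lie_apply, h1, h2, map_zero, map_zero, sub_zero]
  | zero => simp
  | add x y _ _ hx hy => rw [map_add, LinearMap.add_apply, hx, hy, add_zero]
  | smul t x _ hx => rw [map_smul, LinearMap.smul_apply, hx, smul_zero]

theorem swap_upper_apply (H : ((gBarSystem R).map φ).IsHighestWeight lam v) {n : gBar R}
    (hn : n ∈ (gBarSystem R).swap.upper) (x : W) :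
    φ n x ∈ ((gBarSystem R).map φ).lower v := by
  induction hn using Submodule.span_induction generalizing x with
  | mem y hy =>
    obtain ⟨⟨i, w⟩, rfl⟩ := hy
    induction w generalizing x with
    | nil => exact H.f_mem_lower i x
    | cons j w ih =>
      dsimp only
      rw [ChevalleySystem.eBracket, lie_apply]
      exact sub_mem (H.f_mem_lower j _) (ih _)
  | zero => simp
  | add y z _ _ hy hz => rw [map_add, LinearMap.add_apply]; exact add_mem (hy x) (hz x)
  | smul t y _ hy =>
    rw [map_smul, LinearMap.smul_apply]
    exact Submodule.smul_mem _ _ (hy x)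

/-- The radical of `ḡ(A)` acts by zero on a simple highest weight module. -/
theorem radIdeal_le_ker (H : ((gBarSystem R).map φ).IsHighestWeight lam v)
    (hrad : ((gBarSystem R).map φ).rad v = ⊥) : radIdeal R ≤ φ.ker := by
  refine sSup_le fun I hI y hy => ?_
  -- An element of `I` has no component in `𝔥`, so on `v` only its negative part acts; longer words
  -- follow by commuting `y` past the `f i`, since `⁅y, f i⁆ ∈ I`.
  have h1 : ∀ w : List ι, ∀ y ∈ I,
      φ y (((gBarSystem R).map φ).fWord w v) ∈ ((gBarSystem R).map φ).lower v := by
    intro w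
    induction w with
    | nil =>
      intro y hy
      obtain ⟨p, hp, x, n, hn, rfl⟩ := ChevalleySystem.exists_triangular
        (gBarSystem_generates R) y
      have hx : (gBarSystem R).h x = 0 := hI x
        (ChevalleySystem.h_mem_of_mem_ideal R.linearIndependent_root I hp hn hy)
      rw [ChevalleySystem.fWord_nil_apply, hx, add_zero, map_add, LinearMap.add_apply,
        upper_apply H hp, zero_add]
      exact swap_upper_apply H hn v
    | cons i w ih =>
      intro y hy
      have h2 := lie_apply φ y ((gBarSystem R).f i) (((gBarSystem R).map φ).fWord w v)
      rw [eq_sub_iff_add_eq] at h2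
      rw [ChevalleySystem.fWord_cons_apply]
      change φ y (φ ((gBarSystem R).f i) _) ∈ _
      rw [← h2]
      exact add_mem (ih _ (lie_mem_left ℂ _ I _ _ hy)) (H.f_mem_lower i _)
  have h2 : ∀ y ∈ I, ∀ x, φ y x ∈ ((gBarSystem R).map φ).lower v := by
    intro y hy x
    have hx : x ∈ Submodule.span ℂ (Set.range fun w => ((gBarSystem R).map φ).fWord w v) :=
      H.span_eq_top.ge Submodule.mem_top
    induction hx using Submodule.span_induction with
    | mem x hx =>
      obtain ⟨w, rfl⟩ := hx
      exact h1 w y hy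
    | zero => simp
    | add a b _ _ ha hb => rw [map_add]; exact add_mem ha hb
    | smul t a _ ha => rw [map_smul]; exact Submodule.smul_mem _ _ ha
  -- Commuting the `e k` past `y` stays within `I`; hence the image of `y` lies in the radical,
  -- which is zero.
  have h3 : ∀ u : List ι, ∀ y ∈ I, ∀ x,
      ((gBarSystem R).map φ).eWord u (φ y x) ∈ ((gBarSystem R).map φ).lower v := by
    intro u
    induction u using List.reverseRecOn with
    | nil => exact h2
    | append_singleton u k ih =>
      intro y hy x
      rw [ChevalleySystem.eWord_append_apply, ChevalleySystem.eWord_cons_apply,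
        ChevalleySystem.eWord_nil_apply]
      have h4 := lie_apply φ ((gBarSystem R).e k) y x
      rw [eq_sub_iff_add_eq] at h4
      change ((gBarSystem R).map φ).eWord u (φ ((gBarSystem R).e k) (φ y x)) ∈ _
      rw [← h4, map_add]
      exact add_mem (ih _ (lie_mem_right ℂ _ I _ _ hy) _) (ih y hy _)
  rw [LieHom.mem_ker]
  ext x
  have h4 : φ y x ∈ ((gBarSystem R).map φ).rad v :=
    ChevalleySystem.mem_rad.2 fun u => h3 u y hy x
  rw [hrad] at h4
  simpa using h4

end Radical

variable (R) in
/-- The simple highest weight module over `𝔤(A)`. -/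
theorem exists_highestWeight_rep (hA : IsGCM A) (lam : Dual ℂ 𝔥) :
    ∃ (K : Submodule ℂ (List ι →₀ ℂ)) (ρ : KM R →ₗ⁅ℂ⁆ Module.End ℂ ((List ι →₀ ℂ) ⧸ K))
      (v : (List ι →₀ ℂ) ⧸ K), ((kmSystem R).map ρ).IsHighestWeight lam v := by
  classical
  have H := ChevalleySystem.isHighestWeight_wordSystem R.root R.coroot lam
  set D := ChevalleySystem.wordSystem R.root R.coroot lam
  have HL := ChevalleySystem.isHighestWeight_quot_rad R.linearIndependent_root H
  have hrad := ChevalleySystem.rad_quot_rad H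
  set DL := D.quot _ H.isStable_rad
  obtain ⟨φ, hφ⟩ := exists_gBar_hom DL
    (fun i j hij => HL.serre_e_eq_zero hA R.root_coroot hij) (fun i j hij => by
      refine LinearMap.ext fun x => ?_
      have := HL.serre_f_mem_rad hA R.root_coroot hij x
      rw [hrad] at this
      simpa using this)
  rw [← hφ] at HL hrad
  exact ⟨_, lieQuotLift (radIdeal R) φ (radIdeal_le_ker HL hrad), _, HL⟩

end System

/-! ### Tensor products of representations. -/

section Tensor

open TensorProduct

variable {L W₁ W₂ : Type*} [LieRing L] [LieAlgebra ℂ L] [AddCommGroup W₁] [Module ℂ W₁]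
  [AddCommGroup W₂] [Module ℂ W₂]

/-- The tensor product of two representations. -/
def tensorRep (ρ₁ : L →ₗ⁅ℂ⁆ Module.End ℂ W₁) (ρ₂ : L →ₗ⁅ℂ⁆ Module.End ℂ W₂) :
    L →ₗ⁅ℂ⁆ Module.End ℂ (W₁ ⊗[ℂ] W₂) where
  toFun x := (ρ₁ x).rTensor W₂ + (ρ₂ x).lTensor W₁
  map_add' x y := by
    rw [map_add, map_add, LinearMap.rTensor_add, LinearMap.lTensor_add]
    abel
  map_smul' t x := by
    rw [map_smul, map_smul, LinearMap.rTensor_smul, LinearMap.lTensor_smul, smul_add,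
      RingHom.id_apply]
  map_lie' {x y} := by
    ext a b
    simp [LieRing.of_associative_ring_bracket]
    abel

theorem tensorRep_tmul (ρ₁ : L →ₗ⁅ℂ⁆ Module.End ℂ W₁) (ρ₂ : L →ₗ⁅ℂ⁆ Module.End ℂ W₂) (x : L)
    (a : W₁) (b : W₂) : tensorRep ρ₁ ρ₂ x (a ⊗ₜ b) = ρ₁ x a ⊗ₜ b + a ⊗ₜ ρ₂ x b := by
  simp [tensorRep]

end Tensor

/-- The value `-1` serves only as a number outside `ℕ`, so that no monomial in the `f i` kills the
highest weight vector of the simple module. -/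
theorem exists_dual_apply_eq_neg_one {ι 𝔥 : Type*} [AddCommGroup 𝔥] [Module ℂ 𝔥] {c : ι → 𝔥}
    (hc : LinearIndependent ℂ c) : ∃ μ : Dual ℂ 𝔥, ∀ i, μ (c i) = -1 := by
  obtain ⟨μ, hμ⟩ := LinearMap.exists_extend ((Basis.span hc).constr ℂ fun _ => (-1 : ℂ))
  refine ⟨μ, fun i => ?_⟩
  have h := LinearMap.congr_fun hμ (Basis.span hc i)
  rw [Basis.constr_basis, LinearMap.comp_apply, Submodule.subtype_apply, Basis.span_apply] at h
  exact h

/-! ### The Verma module: its monomials are nonzero and span. -/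

section Main

universe u

variable {ι : Type u} [Fintype ι] {A : Matrix ι ι ℤ}
  {𝔥 : Type*} [AddCommGroup 𝔥] [Module ℂ 𝔥] (R : Realization A 𝔥) (lam : Dual ℂ 𝔥)

theorem kmSystem_map_ad_f_nilpotent {W : Type*} [AddCommGroup W] [Module ℂ W]
    (ρ : KM R →ₗ⁅ℂ⁆ Module.End ℂ W) (i j : ι) :
    ∃ N : ℕ, ((LieAlgebra.ad ℂ (Module.End ℂ W) (((kmSystem R).map ρ).f i)) ^ N)
      (((kmSystem R).map ρ).f j) = 0 := by
  obtain ⟨N, hN⟩ := kmSystem_ad_f_nilpotent R i j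
  refine ⟨N, ?_⟩
  have := congr_arg ρ hN
  rwa [map_ad_pow, map_zero] at this

open TensorProduct in
/-- There is a representation with a vector of highest weight `lam` on which no product of the
`f i` vanishes. -/
theorem exists_rep_fWord_ne_zero (hA : IsGCM A) :
    ∃ (W : Type u) (_ : AddCommGroup W) (_ : Module ℂ W) (ρ : KM R →ₗ⁅ℂ⁆ Module.End ℂ W) (v : W),
      (∀ i, ρ ((kmSystem R).e i) v = 0) ∧ (∀ x, ρ ((kmSystem R).h x) v = lam x • v) ∧
      ∀ w, ((kmSystem R).map ρ).fWord w v ≠ 0 := by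
  obtain ⟨μ, hμ⟩ := exists_dual_apply_eq_neg_one R.linearIndependent_coroot
  obtain ⟨K₁, ρ₁, v₁, H₁⟩ := exists_highestWeight_rep R hA μ
  obtain ⟨K₂, ρ₂, v₂, H₂⟩ := exists_highestWeight_rep R hA (lam - μ)
  refine ⟨_, inferInstance, inferInstance, tensorRep ρ₁ ρ₂, v₁ ⊗ₜ v₂, fun i => ?_, fun x => ?_,
    fun w => ?_⟩
  · have h1 : ρ₁ ((kmSystem R).e i) v₁ = 0 := H₁.e_apply i
    have h2 : ρ₂ ((kmSystem R).e i) v₂ = 0 := H₂.e_apply i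
    rw [tensorRep_tmul, h1, h2, zero_tmul, tmul_zero, add_zero]
  · have h1 : ρ₁ ((kmSystem R).h x) v₁ = μ x • v₁ := H₁.h_apply x
    have h2 : ρ₂ ((kmSystem R).h x) v₂ = (lam - μ) x • v₂ := H₂.h_apply x
    rw [tensorRep_tmul, h1, h2, ← smul_tmul', tmul_smul, ← add_smul]
    simp
  -- Contracting the second factor with a functional that kills `lower v₂` but not `v₂` gives a map
  -- `p` commuting with every `f i`, since the term with `f i` on the second factor disappears. It
  -- sends `v₁ ⊗ v₂` to a nonzero multiple of `v₁`.
  · obtain ⟨φ, hφv, hφ⟩ := Submodule.exists_le_ker_of_notMem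
      (H₂.notMem_lower R.linearIndependent_root)
    let p := (TensorProduct.rid ℂ _).toLinearMap ∘ₗ φ.lTensor ((List ι →₀ ℂ) ⧸ K₁)
    have hp : ∀ i t, p (((kmSystem R).map (tensorRep ρ₁ ρ₂)).f i t) =
        ((kmSystem R).map ρ₁).f i (p t) := by
      intro i t
      induction t using TensorProduct.induction_on with
      | zero => simp
      | add a b ha hb => rw [map_add, map_add, map_add, map_add, ha, hb]
      | tmul a b =>
        have h1 : φ (ρ₂ ((kmSystem R).f i) b) = 0 := hφ (H₂.f_mem_lower i b)
        change p (tensorRep ρ₁ ρ₂ ((kmSystem R).f i) (a ⊗ₜ b)) =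
          ρ₁ ((kmSystem R).f i) (p (a ⊗ₜ b))
        simp [tensorRep_tmul, p, h1]
    intro h
    have h1 := ChevalleySystem.map_fWord hp w (v₁ ⊗ₜ[ℂ] v₂)
    rw [h, map_zero] at h1
    have h2 : p (v₁ ⊗ₜ v₂) = φ v₂ • v₁ := by simp [p]
    rw [h2, map_smul] at h1
    refine smul_ne_zero hφv (fun h0 => ?_) h1.symm
    refine H₁.fWord_notMem_rad R.linearIndependent_root
      (fun i => by rw [R.root_coroot, hA.diag]; norm_num)
      (kmSystem_map_ad_f_nilpotent R ρ₁) (w := w) (fun i _ n hn => ?_) ?_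
    · rw [hμ] at hn
      have : (-1 : ℤ) = n := by exact_mod_cast hn
      omega
    · rw [h0]
      exact zero_mem _

/-- The highest weight vector of the Verma module. -/
def vermaVec : Verma R lam := Submodule.Quotient.mk (p := vermaIdeal R lam) 1

/-- The generators of `𝔤(A)` as operators on the Verma module. -/
abbrev vermaSystem : ChevalleySystem (Module.End ℂ (Verma R lam)) R.root R.coroot :=
  (kmSystem R).map (LieModule.toEnd ℂ (KM R) (Verma R lam))

variable {R lam}

/-- The universal property of `M(λ)`: acting on `v` factors through the Verma module. -/
theorem lift_apply_of_mem_vermaIdeal {W : Type*} [AddCommGroup W] [Module ℂ W]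
    (ρ : KM R →ₗ⁅ℂ⁆ Module.End ℂ W) {v : W} (he : ∀ i, ρ ((kmSystem R).e i) v = 0)
    (hh : ∀ x, ρ ((kmSystem R).h x) v = lam x • v) {u : U R} (hu : u ∈ vermaIdeal R lam) :
    UniversalEnvelopingAlgebra.lift ℂ ρ u v = 0 := by
  induction hu using Submodule.span_induction with
  | mem u hu =>
    rcases hu with ⟨y, hy, rfl⟩ | ⟨x, rfl⟩
    · rw [UniversalEnvelopingAlgebra.lift_ι_apply]
      let K : LieSubalgebra ℂ (KM R) :=
        { carrier := {y | ρ y v = 0}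
          add_mem' := fun {a b} ha hb => by
            have ha' : ρ a v = 0 := ha
            have hb' : ρ b v = 0 := hb
            change ρ (a + b) v = 0
            rw [map_add, LinearMap.add_apply, ha', hb', add_zero]
          zero_mem' := by simp
          smul_mem' := fun t a ha => by
            have ha' : ρ a v = 0 := ha
            change ρ (t • a) v = 0
            rw [map_smul, LinearMap.smul_apply, ha', smul_zero]
          lie_mem' := fun {a b} ha hb => by
            have ha' : ρ a v = 0 := ha
            have hb' : ρ b v = 0 := hb
            change ρ ⁅a, b⁆ v = 0
            rw [lie_apply, ha', hb', map_zero, map_zero, sub_zero] }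
      have hK : nPlus R ≤ K := by
        rw [nPlus, LieSubalgebra.lieSpan_le]
        rintro _ ⟨i, rfl⟩
        exact he i
      exact hK hy
    · have h1 : ρ (KM.h R x) v = lam x • v := hh x
      rw [map_sub, UniversalEnvelopingAlgebra.lift_ι_apply, LinearMap.sub_apply, h1,
        AlgHom.commutes, Module.algebraMap_end_apply, sub_self]
  | zero => simp
  | add a b _ _ ha hb => rw [map_add, LinearMap.add_apply, ha, hb, add_zero]
  | smul a b _ hb => rw [smul_eq_mul, map_mul, Module.End.mul_apply, hb, map_zero]

theorem vermaSystem_fWord (w : List ι) :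
    (vermaSystem R lam).fWord w (vermaVec R lam) = Submodule.Quotient.mk (p := vermaIdeal R lam)
      (w.map fun i => UniversalEnvelopingAlgebra.ι ℂ ((kmSystem R).f i)).prod := by
  induction w with
  | nil => rfl
  | cons i w ih =>
    rw [ChevalleySystem.fWord_cons_apply, ih, List.map_cons, List.prod_cons]
    rfl

theorem vermaSystem_fWord_ne_zero (hA : IsGCM A) (w : List ι) :
    (vermaSystem R lam).fWord w (vermaVec R lam) ≠ 0 := by
  obtain ⟨W, _, _, ρ, v, he, hh, hv⟩ := exists_rep_fWord_ne_zero R lam hA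
  intro h
  rw [vermaSystem_fWord] at h
  have h1 := lift_apply_of_mem_vermaIdeal ρ he hh ((Submodule.Quotient.mk_eq_zero _).1 h)
  refine hv w ?_
  rw [← h1, map_list_prod, List.map_map, ChevalleySystem.fWord]
  congr 3
  funext i
  exact (UniversalEnvelopingAlgebra.lift_ι_apply ℂ ρ _).symm

theorem universalEnveloping_adjoin_eq_top (L : Type*) [LieRing L] [LieAlgebra ℂ L] :
    Algebra.adjoin ℂ (Set.range (UniversalEnvelopingAlgebra.ι ℂ : L → _)) = ⊤ := by
  set S := Algebra.adjoin ℂ (Set.range (UniversalEnvelopingAlgebra.ι ℂ : L → _))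
  let g : L →ₗ⁅ℂ⁆ S :=
    { toFun := fun x => ⟨UniversalEnvelopingAlgebra.ι ℂ x, Algebra.subset_adjoin ⟨x, rfl⟩⟩
      map_add' := fun x y => Subtype.ext (map_add _ _ _)
      map_smul' := fun t x => Subtype.ext (map_smul _ _ _)
      map_lie' := fun {x y} => Subtype.ext (LieHom.map_lie _ _ _) }
  have h : S.val.comp (UniversalEnvelopingAlgebra.lift ℂ g) = AlgHom.id ℂ _ := by
    refine UniversalEnvelopingAlgebra.hom_ext ℂ (LieHom.ext fun x => ?_)
    change ((UniversalEnvelopingAlgebra.lift ℂ g (UniversalEnvelopingAlgebra.ι ℂ x) : S) :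
      UniversalEnvelopingAlgebra ℂ L) = UniversalEnvelopingAlgebra.ι ℂ x
    rw [UniversalEnvelopingAlgebra.lift_ι_apply]
    rfl
  rw [eq_top_iff]
  intro u _
  have h1 := AlgHom.congr_fun h u
  rw [AlgHom.comp_apply, AlgHom.id_apply] at h1
  rw [← h1]
  exact Subtype.property _

theorem isHighestWeight_verma (hA : IsGCM A) :
    (vermaSystem R lam).IsHighestWeight lam (vermaVec R lam) := by
  have he : ∀ i, (vermaSystem R lam).e i (vermaVec R lam) = 0 := by
    intro i
    have h : UniversalEnvelopingAlgebra.ι ℂ (KM.e R i) ∈ vermaIdeal R lam :=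
      Submodule.subset_span (Or.inl ⟨_, LieSubalgebra.subset_lieSpan ⟨i, rfl⟩, rfl⟩)
    have h2 := (Submodule.Quotient.mk_eq_zero _).2 h
    rw [← mul_one (UniversalEnvelopingAlgebra.ι ℂ (KM.e R i))] at h2
    exact h2
  have hh : ∀ x, (vermaSystem R lam).h x (vermaVec R lam) = lam x • vermaVec R lam := by
    intro x
    have h : UniversalEnvelopingAlgebra.ι ℂ (KM.h R x) - algebraMap ℂ (U R) (lam x) ∈
        vermaIdeal R lam := Submodule.subset_span (Or.inr ⟨x, rfl⟩)
    have h2 := (Submodule.Quotient.eq _).2 h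
    rw [← mul_one (UniversalEnvelopingAlgebra.ι ℂ (KM.h R x)), Algebra.algebraMap_eq_smul_one]
      at h2
    exact h2
  have hw := mem_weightSubspace.2 hh
  refine ⟨vermaSystem_fWord_ne_zero hA [], he, hw, ?_⟩
  -- `T` is stable under `h` and `f`, hence under `e` by commuting it to the right, hence under `𝔤`
  -- and `U(𝔤)`; it contains the class of `1`.
  set T := Submodule.span ℂ (Set.range fun w => (vermaSystem R lam).fWord w (vermaVec R lam))
  have hlift : ∀ P : Module.End ℂ (Verma R lam),
      (∀ w, P ((vermaSystem R lam).fWord w (vermaVec R lam)) ∈ T) → ∀ t ∈ T, P t ∈ T := by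
    intro P hP t ht
    induction ht using Submodule.span_induction with
    | mem x hx =>
      obtain ⟨w, rfl⟩ := hx
      exact hP w
    | zero => simp
    | add a b _ _ ha hb => rw [map_add]; exact add_mem ha hb
    | smul t a _ ha => rw [map_smul]; exact Submodule.smul_mem _ _ ha
  have hT : ∀ w, (vermaSystem R lam).fWord w (vermaVec R lam) ∈ T := fun w =>
    Submodule.subset_span ⟨w, rfl⟩
  have hTh : ∀ x, ∀ t ∈ T, (vermaSystem R lam).h x t ∈ T := fun x =>
    hlift _ fun w => by
      rw [mem_weightSubspace.1 (ChevalleySystem.fWord_mem_weightSubspace w hw) x]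
      exact Submodule.smul_mem _ _ (hT w)
  have hTf : ∀ i, ∀ t ∈ T, (vermaSystem R lam).f i t ∈ T := fun i =>
    hlift _ fun w => by
      rw [← ChevalleySystem.fWord_cons_apply]
      exact hT _
  have hTe : ∀ i, ∀ t ∈ T, (vermaSystem R lam).e i t ∈ T := fun i =>
    hlift _ fun w => by
      induction w with
      | nil => rw [ChevalleySystem.fWord_nil_apply, he]; exact zero_mem _
      | cons j w ih =>
        rw [ChevalleySystem.fWord_cons_apply]
        by_cases h : i = j
        · subst h
          rw [ChevalleySystem.e_f_apply_same]
          exact add_mem (hTf _ _ ih) (hTh _ _ (hT w))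
        · rw [ChevalleySystem.e_f_apply_ne _ h]
          exact hTf _ _ ih
  have hg : ∀ (y : KM R), ∀ t ∈ T, ⁅y, t⁆ ∈ T := by
    let K : LieSubalgebra ℂ (KM R) :=
      { carrier := {y | ∀ t ∈ T, ⁅y, t⁆ ∈ T}
        add_mem' := fun ha hb t ht => by rw [add_lie]; exact add_mem (ha t ht) (hb t ht)
        zero_mem' := fun t _ => by simp
        smul_mem' := fun a x hx t ht => by rw [smul_lie]; exact T.smul_mem a (hx t ht)
        lie_mem' := fun {x y} hx hy t ht => by
          rw [lie_lie]
          exact sub_mem (hx _ (hy _ ht)) (hy _ (hx _ ht)) }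
    have hK : K = ⊤ := kmSystem_generates R K hTe hTf hTh
    intro y
    exact (hK.ge (LieSubalgebra.mem_top y) : y ∈ K)
  have hu : ∀ u : U R, ∀ t ∈ T, u • t ∈ T := by
    intro u
    have hu : u ∈ Algebra.adjoin ℂ (Set.range (UniversalEnvelopingAlgebra.ι ℂ : KM R → _)) := by
      rw [universalEnveloping_adjoin_eq_top]
      trivial
    induction hu using Algebra.adjoin_induction with
    | mem u hu =>
      obtain ⟨y, rfl⟩ := hu
      exact hg y
    | algebraMap a =>
      intro t ht
      rw [algebraMap_smul]
      exact T.smul_mem a ht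
    | add a b _ _ ha hb =>
      intro t ht
      rw [add_smul]
      exact add_mem (ha t ht) (hb t ht)
    | mul a b _ _ ha hb =>
      intro t ht
      rw [mul_smul]
      exact ha _ (hb t ht)
  rw [eq_top_iff]
  intro m _
  obtain ⟨u, rfl⟩ := Submodule.Quotient.mk_surjective (vermaIdeal R lam) m
  have := hu u _ (hT [])
  rw [← mul_one u]
  exact this

end Main

/-! ### Weights of the Verma module and of its quotients. -/

section Weights

variable {ι : Type*} [Fintype ι] {A : Matrix ι ι ℤ}
  {𝔥 : Type*} [AddCommGroup 𝔥] [Module ℂ 𝔥] (R : Realization A 𝔥) {lam : Dual ℂ 𝔥}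

theorem mem_weightSpace_iff {M : Type*} [AddCommGroup M] [Module ℂ M] [LieRingModule (KM R) M]
    [LieModule ℂ (KM R) M] {μ : Dual ℂ 𝔥} {m : M} : m ∈ weightSpace R M μ ↔
      m ∈ weightSubspace ((kmSystem R).map (LieModule.toEnd ℂ (KM R) M)).h μ :=
  ⟨fun h => mem_weightSubspace.2 h, fun h => mem_weightSubspace.1 h⟩

theorem mem_wt_iff {M : Type*} [AddCommGroup M] [Module ℂ M] [LieRingModule (KM R) M]
    [LieModule ℂ (KM R) M] {μ : Dual ℂ 𝔥} : μ ∈ wt R M ↔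
      ∃ m ≠ 0, m ∈ weightSubspace ((kmSystem R).map (LieModule.toEnd ℂ (KM R) M)).h μ := by
  rw [wt, Set.mem_ofPred_eq, Submodule.ne_bot_iff]
  exact ⟨fun ⟨m, h1, h2⟩ => ⟨m, h2, (mem_weightSpace_iff R).1 h1⟩,
    fun ⟨m, h1, h2⟩ => ⟨m, (mem_weightSpace_iff R).2 h2, h1⟩⟩

theorem mem_wt_submodule_iff {K : LieSubmodule ℂ (KM R) (Verma R lam)} {μ : Dual ℂ 𝔥} :
    μ ∈ wt R K ↔ ∃ m ∈ K, m ≠ 0 ∧ m ∈ weightSubspace (vermaSystem R lam).h μ := by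
  rw [wt, Set.mem_ofPred_eq, Submodule.ne_bot_iff]
  constructor
  · rintro ⟨m, h1, h2⟩
    exact ⟨m, m.2, fun h => h2 (Subtype.ext h),
      mem_weightSubspace.2 fun x => congr_arg Subtype.val (h1 x)⟩
  · rintro ⟨m, hm, h1, h2⟩
    exact ⟨⟨m, hm⟩, fun x => Subtype.ext (mem_weightSubspace.1 h2 x),
      fun h => h1 (congr_arg Subtype.val h)⟩

theorem supp_wordWeight (w : List ι) : supp R (wordWeight R.root w) = {i | i ∈ w} := by
  classical
  have hsum : ∀ w : List ι, wordWeight R.root w = ∑ i, (w.count i : ℂ) • R.root i := by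
    intro w
    induction w with
    | nil => simp
    | cons j w ih =>
      simp only [wordWeight_cons, ih, List.count_cons, Nat.cast_add, add_smul,
        Finset.sum_add_distrib]
      rw [add_comm]
      congr 1
      simp
  ext i
  rw [supp, Set.mem_ofPred_eq, Set.mem_ofPred_eq, ← List.count_pos_iff, Nat.pos_iff_ne_zero]
  constructor
  · rintro ⟨c, hc, hi⟩ h0
    rw [hsum] at hc
    have h := Fintype.linearIndependent_iff.1 R.linearIndependent_root
      (fun j => (w.count j : ℂ) - c j) (by simp [sub_smul, Finset.sum_sub_distrib, hc]) i
    rw [h0, Nat.cast_zero, zero_sub, neg_eq_zero] at h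
    exact hi h
  · intro h
    exact ⟨_, hsum w, by exact_mod_cast h⟩

theorem edgeSet_nonempty_iff (hA : IsGCM A) (w : List ι) :
    ((dynkinGraph A).induce (supp R (wordWeight R.root w))).edgeSet.Nonempty ↔
      ∃ i ∈ w, ∃ j ∈ w, i ≠ j ∧ A i j ≠ 0 := by
  rw [supp_wordWeight]
  constructor
  · rintro ⟨⟨a, b⟩, h⟩
    have h1 : (dynkinGraph A).Adj a.1 b.1 := h
    rw [dynkinGraph, SimpleGraph.fromRel_adj] at h1
    refine ⟨a.1, a.2, b.1, b.2, h1.1, h1.2.elim id fun h2 h3 => h2 (hA.zero_symm _ _ h3)⟩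
  · rintro ⟨i, hi, j, hj, hij, h⟩
    refine ⟨s(⟨i, hi⟩, ⟨j, hj⟩), ?_⟩
    rw [SimpleGraph.mem_edgeSet, SimpleGraph.induce_adj, dynkinGraph, SimpleGraph.fromRel_adj]
    exact ⟨hij, Or.inl h⟩

theorem hasEdgeProperty_iff (hA : IsGCM A) {K : LieSubmodule ℂ (KM R) (Verma R lam)} :
    HasEdgeProperty R lam K ↔ ∀ (w : List ι), ∀ m ∈ K, m ≠ 0 →
      m ∈ weightSubspace (vermaSystem R lam).h (lam - wordWeight R.root w) →
      ∃ i ∈ w, ∃ j ∈ w, i ≠ j ∧ A i j ≠ 0 := by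
  constructor
  · intro h w m hm hm0 hw
    have := h _ ((mem_wt_submodule_iff R).2 ⟨m, hm, hm0, hw⟩)
    rwa [sub_sub_cancel, edgeSet_nonempty_iff R hA] at this
  · intro h μ hμ
    obtain ⟨m, hm, hm0, hw⟩ := (mem_wt_submodule_iff R).1 hμ
    obtain ⟨w, rfl⟩ := (isHighestWeight_verma hA).exists_word_of_weightSubspace_ne_bot hm0 hw
    rw [sub_sub_cancel, edgeSet_nonempty_iff R hA]
    exact h w m hm hm0 hw

/-- Submodules are graded, so a weight of a sum of submodules is already a weight of one summand. -/
theorem hasEdgeProperty_N (hA : IsGCM A) : HasEdgeProperty R lam (N R lam) := by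
  have H := isHighestWeight_verma (R := R) (lam := lam) hA
  rw [hasEdgeProperty_iff R hA]
  intro w m hm hm0 hw
  have hm' : m ∈ sSup (LieSubmodule.toSubmodule ''
      {K : LieSubmodule ℂ (KM R) (Verma R lam) | K ≠ ⊤ ∧ HasEdgeProperty R lam K}) := by
    rw [N, ← LieSubmodule.mem_toSubmodule, LieSubmodule.sSup_toSubmodule] at hm
    exact hm
  obtain ⟨_, ⟨K, hK, rfl⟩, y, hy, hyw, hy0⟩ := exists_inf_weightSubspace_ne_bot H.fWord_mem
    H.span_eq_top (by
      rintro _ ⟨K, -, rfl⟩ x t ht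
      exact K.lie_mem ht) hm0 hm' hw
  exact (hasEdgeProperty_iff R hA).1 hK.2 w y hy hy0 hyw

/-- The weight `lam` corresponds to the empty word, whose support carries no edge. -/
theorem ne_top_of_hasEdgeProperty (hA : IsGCM A) {K : LieSubmodule ℂ (KM R) (Verma R lam)}
    (hK : HasEdgeProperty R lam K) : K ≠ ⊤ := by
  have H := isHighestWeight_verma (R := R) (lam := lam) hA
  rintro rfl
  obtain ⟨i, hi, -⟩ := (hasEdgeProperty_iff R hA).1 hK [] _ (LieSubmodule.mem_top _) H.ne_zero
    (by simpa using H.mem_weight)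
  simp at hi

theorem isGreatest_N (hA : IsGCM A) :
    IsGreatest {K : LieSubmodule ℂ (KM R) (Verma R lam) | K ≠ ⊤ ∧ HasEdgeProperty R lam K}
      (N R lam) :=
  ⟨⟨ne_top_of_hasEdgeProperty R hA (hasEdgeProperty_N R hA), hasEdgeProperty_N R hA⟩,
    fun _ hK => le_sSup hK⟩

variable {R}

theorem mem_wt_verma_iff (hA : IsGCM A) {μ : Dual ℂ 𝔥} :
    μ ∈ wt R (Verma R lam) ↔ ∃ w : List ι, μ = lam - wordWeight R.root w := by
  have H := isHighestWeight_verma (R := R) (lam := lam) hA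
  rw [mem_wt_iff]
  constructor
  · rintro ⟨m, hm0, hm⟩
    exact H.exists_word_of_weightSubspace_ne_bot hm0 hm
  · rintro ⟨w, rfl⟩
    exact ⟨_, vermaSystem_fWord_ne_zero hA w, H.fWord_mem w⟩

variable {V : Type*} [AddCommGroup V] [Module ℂ V] [LieRingModule (KM R) V]
  [LieModule ℂ (KM R) V] {p : Verma R lam →ₗ⁅ℂ, KM R⁆ V}

/-- A quotient of the Verma module by a submodule with the edge property has the same weights. -/
theorem wt_eq_of_hasEdgeProperty_ker (hA : IsGCM A) (hp : Function.Surjective p)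
    (hker : HasEdgeProperty R lam p.ker) : wt R V = wt R (Verma R lam) := by
  have H := isHighestWeight_verma (R := R) (lam := lam) hA
  let D := (kmSystem R).map (LieModule.toEnd ℂ (KM R) V)
  have hf : ∀ i w, (p : Verma R lam →ₗ[ℂ] V) ((vermaSystem R lam).f i w) =
      D.f i ((p : Verma R lam →ₗ[ℂ] V) w) := fun i w => p.map_lie _ w
  -- A monomial over non-adjacent letters killed by `p` would be a nonzero weight vector of the
  -- kernel whose support has no edge.
  have hmap : ∀ w : List ι, (∀ i ∈ w, ∀ j ∈ w, i ≠ j → A i j = 0) →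
      D.fWord w (p (vermaVec R lam)) ≠ 0 := by
    intro w hw h0
    have h1 : (vermaSystem R lam).fWord w (vermaVec R lam) ∈ p.ker := by
      rw [LieModuleHom.mem_ker]
      exact (ChevalleySystem.map_fWord hf w _).trans h0
    obtain ⟨i, hi, j, hj, hij, h⟩ := (hasEdgeProperty_iff R hA).1 hker w _ h1
      (vermaSystem_fWord_ne_zero hA w) (H.fWord_mem w)
    exact h (hw i hi j hj hij)
  have HV : D.IsHighestWeight lam (p (vermaVec R lam)) :=
    H.map (p := (p : Verma R lam →ₗ[ℂ] V)) (fun i w => p.map_lie _ w) hf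
      (fun x w => p.map_lie _ w) hp (hmap [] (by simp))
  ext μ
  rw [mem_wt_verma_iff hA, mem_wt_iff]
  constructor
  · rintro ⟨m, hm0, hm⟩
    exact HV.exists_word_of_weightSubspace_ne_bot hm0 hm
  · rintro ⟨w, rfl⟩
    exact HV.exists_mem_weightSubspace R.linearIndependent_root hA R.root_coroot
      (kmSystem_map_ad_f_nilpotent R _) hmap w

/-- The kernel of a quotient of the Verma module with the same weights has the edge property. -/
theorem hasEdgeProperty_ker_of_wt_eq (hA : IsGCM A) (hp : Function.Surjective p)
    (hwt : wt R V = wt R (Verma R lam)) : HasEdgeProperty R lam p.ker := by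
  have H := isHighestWeight_verma (R := R) (lam := lam) hA
  rw [hasEdgeProperty_iff R hA]
  intro w m hm hm0 hmw
  by_contra! hw
  have hcomm : ∀ i ∈ w, ∀ j ∈ w, ⁅(vermaSystem R lam).f i, (vermaSystem R lam).f j⁆ = 0 := by
    intro i hi j hj
    have h1 := kmSystem_lie_f_f R (hw i hi j hj)
    have h2 := congr_arg (LieModule.toEnd ℂ (KM R) (Verma R lam)) h1
    rwa [LieHom.map_lie, map_zero] at h2
  -- The weight space is a line, so the kernel contains all of it.
  obtain ⟨t, rfl⟩ := H.exists_smul_of_pairwise R.linearIndependent_root hcomm hmw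
  have ht : t ≠ 0 := by
    rintro rfl
    simp at hm0
  have hzero : p ((vermaSystem R lam).fWord w (vermaVec R lam)) = 0 := by
    rw [LieModuleHom.mem_ker, map_smul] at hm
    exact (smul_eq_zero.1 hm).resolve_left ht
  have hμ : lam - wordWeight R.root w ∈ wt R V := by
    rw [hwt, mem_wt_verma_iff hA]
    exact ⟨w, rfl⟩
  obtain ⟨x, hx0, hx⟩ := (mem_wt_iff R).1 hμ
  obtain ⟨y, rfl⟩ := hp x
  obtain ⟨a, ha, b, hb, rfl⟩ := exists_add_of_mem_span H.fWord_mem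
    (lam - wordWeight R.root w) (H.span_eq_top.ge (Submodule.mem_top (x := y)))
  obtain ⟨s, rfl⟩ := H.exists_smul_of_pairwise R.linearIndependent_root hcomm
    (span_image_le_weightSubspace H.fWord_mem _ ha)
  rw [map_add, map_smul, hzero, smul_zero, zero_add] at hx hx0
  -- With the component on that line killed, `x` is the image of a sum of vectors of other weights,
  -- so it cannot be a nonzero vector of this weight.
  refine hx0 (eq_zero_of_mem_otherWeights hx ?_)
  have hle : otherWeights (vermaSystem R lam).h (lam - wordWeight R.root w) ≤
      (otherWeights ((kmSystem R).map (LieModule.toEnd ℂ (KM R) V)).h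
        (lam - wordWeight R.root w)).comap (p : Verma R lam →ₗ[ℂ] V) := by
    refine iSup_le fun ν z hz => weightSubspace_le_otherWeights ν.2 ?_
    exact ChevalleySystem.map_mem_weightSubspace (p := (p : Verma R lam →ₗ[ℂ] V))
      (fun x w => p.map_lie _ w) hz
  exact hle hb

end Weights

end KacMoody

end

open KacMoody in
theorem proposition2p7 {ι : Type*} [Fintype ι] [DecidableEq ι] (A : Matrix ι ι ℤ) (hA : IsGCM A)
    {𝔥 : Type*} [AddCommGroup 𝔥] [Module ℂ 𝔥] (R : Realization A 𝔥) (lam : Module.Dual ℂ 𝔥)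
    {V : Type*} [AddCommGroup V] [Module ℂ V] [LieRingModule (KM R) V] [LieModule ℂ (KM R) V]
    (N_V : LieSubmodule ℂ (KM R) (Verma R lam)) (p : Verma R lam →ₗ⁅ℂ, KM R⁆ V)
    (hp : Function.Surjective p) (hker : p.ker = N_V) :
    IsGreatest {K : LieSubmodule ℂ (KM R) (Verma R lam) | K ≠ ⊤ ∧ HasEdgeProperty R lam K}
        (N R lam) ∧
      (wt R V = wt R (Verma R lam) ↔ N_V ≤ N R lam) := by
  subst hker
  refine ⟨isGreatest_N R hA, fun h => ?_, fun h => ?_⟩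
  · have h1 := hasEdgeProperty_ker_of_wt_eq hA hp h
    exact (isGreatest_N R hA).2 ⟨ne_top_of_hasEdgeProperty R hA h1, h1⟩
  · refine wt_eq_of_hasEdgeProperty_ker hA hp ((hasEdgeProperty_iff R hA).2 fun w m hm => ?_)
    exact (hasEdgeProperty_iff R hA).1 (hasEdgeProperty_N R hA) w m (h hm)
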